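/- **Setting.** Let $n\in\mathbb N$. For $X=\mathbb R^n$ or $X=T\mathbb R^n=\mathbb R^n\times\mathbb R^n$ (with the Euclidean distances), $\mathcal P(X)$ is the set of Borel probability measures on $X$, $\mathcal P_c(X)$ the subset of those with compact support, and $W^X(\mu,\nu)=\inf_\tau\int_{X\times X} d(x,y)\,d\tau(x,y)$, the infimum being over the probability measures $\tau$ on $X\times X$ with marginals $\mu$ and $\nu$; $W=W^{\mathbb R^n}$. A *probability vector field* is a map $V:\mathcal P(\mathbb R^n)\to\mathcal P(T\mathbb R^n)$ with $\pi_1\#V[\mu]=\mu$ for all $\mu$, where $\pi_1(x,v)=x$. Consider the conditions - (H1) with constant $C>0$: for all $\mu\in\mathcal P_c(\mathbb R^n)$, $\ \sup_{(x,v)\in \mathrm{Supp}(V[\mu])}|v|\le C\,\bigl(1+\sup_{x\in \mathrm{Supp}(\mu)}|x|\bigr)$; - (H2): the restriction of $V$ to $\mathcal P_c(\mathbb R^n)$ is continuous for the metrics $W^{\mathbb R^n}$ and $W^{T\mathbb R^n}$. *Solutions.* A (weak) solution on $[0,T]$ of the Cauchy problem $\dot\mu=V[\mu]$, $\mu(0)=\mu_0$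 is a map $\mu:[0,T]\to\mathcal P(\mathbb R^n)$ with $\mu(0)=\mu_0$ such that, for every $f\in C_c^\infty(\mathbb R^n)$: the integral $I_f(s)=\int_{T\mathbb R^n}\nabla f(x)\cdot v\;dV[\mu(s)](x,v)$ is defined for almost every $s\in[0,T]$; $I_f\in L^1([0,T])$; the map $t\mapsto\int f\,d\mu(t)$ is absolutely continuous on $[0,T]$; and $\frac{d}{dt}\int f\,d\mu(t)=I_f(t)$ for almost every $t\in[0,T]$. *Lattice Approximate Solutions (LAS).* For $N\ge1$ let $x_i$ be the points of $(\mathbb Z^n/N^2)\cap[-N,N]^n$ and $v_j$ the points of $(\mathbb Z^n/N)\cap[-N,N]^n$, and let $Q=[0,\frac1{N^2})^n$, $Q'=[0,\frac1N)^n$. Put $m_{ij}(\mu)=V[\mu](\{(x_i,v): v\in v_j+Q'\})$. Given $\mu_0$, define $\mu^N_0=\sum_i\mu_0(x_i+Q)\,\delta_{x_i}$, $\ \mu^N_{\ell+1}=\sum_{i,j}m_{ij}(\mu^N_\ell)\,\delta_{x_i+v_j/N}$, and $\mu^N(\ell/N+t)=\sum_{i,j}m_{ij}(\mu^N_\ell)\,\delta_{x_i+t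 v_j}$ for $0\le t<1/N$ and $\ell\in\mathbb N$. (For small $N$ the truncation to $[-N,N]^n$ may lose mass. When $\mu^N_\ell$ is not a probability measure, $m_{ij}(\mu^N_\ell)$ is taken to be $0$. The distance $W$ to a measure that is not a probability measure is $+\infty$.) **Theorem 3.1.** Let $V$ be a probability vector field satisfying (H1) with constant $C>0$, and (H2). Then for every $T>0$ and $\mu_0\in\mathcal P_c(\mathbb R^n)$ there exists a solution $\mu:[0,T]\to\mathcal P_c(\mathbb R^n)$ of the Cauchy problem $\dot\mu=V[\mu]$, $\mu(0)=\mu_0$, which is a uniform-in-time limit of LASs for the Wasserstein metric along a subsequence: there are $N_1<N_2<\cdots$ with $$\lim_{k\to\infty}\ \sup_{t\in[0,T]}W\bigl(\mu^{N_k}(t),\mu(t)\bigr)=0 .$$ Moreover, for every $R$ such that $\mathrm{Supp}(\mu_0)$ is contained in the closed ball of radius $R$ centered at the origin, $$W(\mu(t),\mu(s))\le C\,e^{CT}(R+1)\,|t-s|\qquad\text{for all } s,t\in[0,T].$$ -/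

import Mathlib

open MeasureTheory Filter Set
open scoped ENNReal Topology ContDiff

namespace MDE

/-! ### Wasserstein distance -/

section Wasserstein

variable {X : Type*} [PseudoEMetricSpace X] [MeasurableSpace X]

/-- The transference plans from `μ` to `ν`: probability measures on `X × X` with marginals
`μ` and `ν`. (The set is empty if `μ` or `ν` is not a probability measure.) -/
def transferencePlans (μ ν : Measure X) : Set (Measure (X × X)) :=
  {τ | IsProbabilityMeasure τ ∧ τ.map Prod.fst = μ ∧ τ.map Prod.snd = ν}

/-- The transportation cost `J(τ) = ∫ d(x,y) dτ(x,y)`. -/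
noncomputable def transportCost (τ : Measure (X × X)) : ℝ≥0∞ :=
  ∫⁻ p, edist p.1 p.2 ∂τ

/-- The Wasserstein distance `W(μ, ν) = inf_τ J(τ)` over the transference plans `τ` from `μ` to
`ν`, with values in `[0, ∞]` (it is `∞` if there are no plans). -/
noncomputable def wasserstein (μ ν : Measure X) : ℝ≥0∞ :=
  ⨅ τ ∈ transferencePlans μ ν, transportCost τ

end Wasserstein

/-! ### Probability vector fields -/

/-- The space `ℝⁿ` with the Euclidean norm. -/
abbrev Space (n : ℕ) : Type := EuclideanSpace ℝ (Fin n)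

/-- The tangent bundle `Tℝⁿ = ℝⁿ × ℝⁿ` with the Euclidean norm of `ℝ²ⁿ`; a point is a pair
`(x, v)`, with `x = p.fst` and `v = p.snd`. -/
abbrev TSpace (n : ℕ) : Type := WithLp 2 (Space n × Space n)

/-- `μ` belongs to `𝒫_c`: it has compact support. -/
def HasCompactSupp {X : Type*} [TopologicalSpace X] [MeasurableSpace X]
    (μ : ProbabilityMeasure X) : Prop :=
  IsCompact (μ : Measure X).support

/-- A probability vector field: a map `V : 𝒫(ℝⁿ) → 𝒫(Tℝⁿ)` with `π₁ # V[μ] = μ`. -/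
structure PVF (n : ℕ) where
  toFun : ProbabilityMeasure (Space n) → ProbabilityMeasure (TSpace n)
  map_fst : ∀ μ : ProbabilityMeasure (Space n),
    (toFun μ : Measure (TSpace n)).map (fun p => p.fst) = (μ : Measure (Space n))

instance (n : ℕ) : CoeFun (PVF n)
    (fun _ => ProbabilityMeasure (Space n) → ProbabilityMeasure (TSpace n)) :=
  ⟨PVF.toFun⟩

/-- `V` is support sublinear with constant `C`: for every compactly supported `μ`,
`sup {|v| : (x,v) ∈ Supp V[μ]} ≤ C (1 + sup {|x| : x ∈ Supp μ})`. Suprema are taken in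
`[0, ∞]`. -/
def PVF.SupportSublinear {n : ℕ} (V : PVF n) (C : ℝ) : Prop :=
  ∀ μ : ProbabilityMeasure (Space n), HasCompactSupp μ →
    (⨆ p ∈ (V μ : Measure (TSpace n)).support, ‖p.snd‖ₑ) ≤
      ENNReal.ofReal C * (1 + ⨆ x ∈ (μ : Measure (Space n)).support, ‖x‖ₑ)

/-- The restriction of `V` to compactly supported measures is continuous for the Wasserstein
metrics of `ℝⁿ` and `Tℝⁿ`. -/
def PVF.WassersteinContinuous {n : ℕ} (V : PVF n) : Prop :=
  ∀ μ : ProbabilityMeasure (Space n), HasCompactSupp μ →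
    ∀ ε : ℝ≥0∞, 0 < ε → ∃ δ : ℝ≥0∞, 0 < δ ∧
      ∀ ν : ProbabilityMeasure (Space n), HasCompactSupp ν →
        wasserstein (ν : Measure (Space n)) (μ : Measure (Space n)) < δ →
        wasserstein (V ν : Measure (TSpace n)) (V μ : Measure (TSpace n)) < ε

/-! ### Weak solutions -/

/-- The function `(x,v) ↦ ∇f(x) · v` on `Tℝⁿ`. -/
noncomputable def gradPairing {n : ℕ} (f : Space n → ℝ) (p : TSpace n) : ℝ :=
  inner ℝ (gradient f p.fst) p.snd

/-- `μ` (only its values on `[0,T]` matter) is a weak solution on `[0,T]` of the Cauchy problem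
`μ̇ = V[μ]`, `μ(0) = μ₀`. -/
def IsSolution {n : ℕ} (V : PVF n) (T : ℝ) (μ₀ : ProbabilityMeasure (Space n))
    (μ : ℝ → ProbabilityMeasure (Space n)) : Prop :=
  μ 0 = μ₀ ∧
  ∀ f : Space n → ℝ, ContDiff ℝ ∞ f → HasCompactSupport f →
    (∀ᵐ s ∂(volume.restrict (Icc 0 T)),
      Integrable (gradPairing f) (V (μ s) : Measure (TSpace n))) ∧
    IntegrableOn (fun s => ∫ p, gradPairing f p ∂(V (μ s) : Measure (TSpace n))) (Icc 0 T) ∧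
    AbsolutelyContinuousOnInterval (fun t => ∫ x, f x ∂(μ t : Measure (Space n))) 0 T ∧
    (∀ᵐ t ∂(volume.restrict (Icc 0 T)),
      HasDerivAt (fun t' => ∫ x, f x ∂(μ t' : Measure (Space n)))
        (∫ p, gradPairing f p ∂(V (μ t) : Measure (TSpace n))) t)

/-! ### Lattice approximate solutions -/

/-- The point `h z` of the lattice `h ℤⁿ`. -/
noncomputable def latticePoint {n : ℕ} (h : ℝ) (z : Fin n → ℤ) : Space n :=
  WithLp.toLp 2 (fun k => h * (z k : ℝ))

/-- The half-open cube `h z + [0, h)ⁿ`. -/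
def latticeCell {n : ℕ} (h : ℝ) (z : Fin n → ℤ) : Set (Space n) :=
  {y | ∀ k, h * (z k : ℝ) ≤ y k ∧ y k < h * (z k : ℝ) + h}

/-- Time step size, which is also the velocity step size: `1/N`. -/
noncomputable def timeStep (N : ℕ) : ℝ := 1 / (N : ℝ)

/-- Space step size: `1/N²`. -/
noncomputable def spaceStep (N : ℕ) : ℝ := 1 / (N : ℝ) ^ 2

/-- The indices `z` of the `(2N³+1)ⁿ` points `z/N²` of `ℤⁿ/N² ∩ [-N,N]ⁿ`. -/
noncomputable def spaceIndices (n N : ℕ) : Finset (Fin n → ℤ) :=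
  Fintype.piFinset fun _ => Finset.Icc (-((N : ℤ) ^ 3)) ((N : ℤ) ^ 3)

/-- The indices `z` of the `(2N²+1)ⁿ` points `z/N` of `ℤⁿ/N ∩ [-N,N]ⁿ`. -/
noncomputable def velIndices (n N : ℕ) : Finset (Fin n → ℤ) :=
  Fintype.piFinset fun _ => Finset.Icc (-((N : ℤ) ^ 2)) ((N : ℤ) ^ 2)

/-- The space discretization `𝒜ˣ_N(μ) = ∑ᵢ μ(xᵢ + Q) δ_{xᵢ}`. -/
noncomputable def discSpace {n : ℕ} (N : ℕ) (μ : Measure (Space n)) : Measure (Space n) :=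
  ∑ i ∈ spaceIndices n N,
    μ (latticeCell (spaceStep N) i) • Measure.dirac (latticePoint (spaceStep N) i)

open Classical in
/-- `V[m]` for a measure `m`; the value is `0` if `m` is not a probability measure. -/
noncomputable def PVF.onMeasure {n : ℕ} (V : PVF n) (m : Measure (Space n)) :
    Measure (TSpace n) :=
  if h : IsProbabilityMeasure m then (V ⟨m, h⟩ : Measure (TSpace n)) else 0

/-- The mass `mᵛᵢⱼ(V[m]) = V[m]({(xᵢ, v) : v ∈ vⱼ + Q'})`. -/
noncomputable def velMass {n : ℕ} (V : PVF n) (N : ℕ) (m : Measure (Space n))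
    (i j : Fin n → ℤ) : ℝ≥0∞ :=
  V.onMeasure m {p | p.fst = latticePoint (spaceStep N) i ∧ p.snd ∈ latticeCell (timeStep N) j}

/-- The measure `∑ᵢ ∑ⱼ mᵛᵢⱼ(V[m]) δ_{xᵢ + t vⱼ}`. -/
noncomputable def lasMove {n : ℕ} (V : PVF n) (N : ℕ) (m : Measure (Space n)) (t : ℝ) :
    Measure (Space n) :=
  ∑ i ∈ spaceIndices n N, ∑ j ∈ velIndices n N,
    velMass V N m i j •
      Measure.dirac (latticePoint (spaceStep N) i + t • latticePoint (timeStep N) j)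

/-- The lattice approximate solution at the time `ℓ/N`. -/
noncomputable def lasGrid {n : ℕ} (V : PVF n) (N : ℕ) (μ₀ : ProbabilityMeasure (Space n)) :
    ℕ → Measure (Space n)
  | 0 => discSpace N (μ₀ : Measure (Space n))
  | ℓ + 1 => lasMove V N (lasGrid V N μ₀ ℓ) (timeStep N)

/-- The lattice approximate solution `μᴺ` at the time `t ≥ 0`: with `ℓ = ⌊N t⌋` it is
`∑ᵢ ∑ⱼ mᵛᵢⱼ(V[μᴺ_ℓ]) δ_{xᵢ + (t - ℓ/N) vⱼ}`. -/
noncomputable def las {n : ℕ} (V : PVF n) (N : ℕ) (μ₀ : ProbabilityMeasure (Space n)) (t : ℝ) :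
    Measure (Space n) :=
  lasMove V N (lasGrid V N μ₀ ⌊(N : ℝ) * t⌋₊) (t - (⌊(N : ℝ) * t⌋₊ : ℝ) * timeStep N)

end MDE

/-!
Every lattice approximate solution coincides on `[0,T]`, for large `N`, with its untruncated
version, because by a discrete Grönwall inequality the latter stays in a ball that does not depend
on `N`. The measures concentrated on that ball form a compact set for the Wasserstein metric, and
the approximate solutions are equi-Lipschitz in time, so a subsequence converges uniformly on
`[0,T]`. Within a time cell of length `1/N` the increment of `∫ f dμᴺ` is the elapsed time
multiplied by `∫ ∇f(x) · v dV[μᴺ_ℓ](x,v) + O(1/N)`. As `V` is continuous, this rate is close to its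
value at the limit `μ(s)` for all cells near `s`; hence the limit
`t ↦ ∫ f dμ(t) - t ∫ ∇f(x) · v dV[μ(s)](x,v)` has arbitrarily small Lipschitz constants near `s`,
which is the equation at the time `s`.
-/

namespace MDE

open scoped NNReal ProbabilityTheory

section Wasserstein

lemma transferencePlans_nonempty {X : Type*} [MeasurableSpace X] (μ ν : Measure X)
    [IsProbabilityMeasure μ] [IsProbabilityMeasure ν] : (transferencePlans μ ν).Nonempty :=
  ⟨μ.prod ν, inferInstance, by simp, by simp⟩

section Plans

variable {X : Type*} [PseudoEMetricSpace X] [MeasurableSpace X]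

lemma wasserstein_le_transportCost {μ ν : Measure X} {τ : Measure (X × X)}
    (h : τ ∈ transferencePlans μ ν) : wasserstein μ ν ≤ transportCost τ :=
  iInf₂_le _ h

lemma wasserstein_le_swap (μ ν : Measure X) : wasserstein ν μ ≤ wasserstein μ ν := by
  refine le_iInf₂ fun τ ⟨_, hfst, hsnd⟩ => ?_
  have hmem : τ.map (MeasurableEquiv.prodComm : X × X ≃ᵐ X × X) ∈ transferencePlans ν μ := by
    refine ⟨Measure.isProbabilityMeasure_map (MeasurableEquiv.measurable _).aemeasurable, ?_, ?_⟩
    · rw [Measure.map_map measurable_fst (MeasurableEquiv.measurable _), ← hsnd]; rfl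
    · rw [Measure.map_map measurable_snd (MeasurableEquiv.measurable _), ← hfst]; rfl
  refine (wasserstein_le_transportCost hmem).trans_eq ?_
  rw [transportCost, lintegral_map_equiv]
  exact lintegral_congr fun p => edist_comm _ _

lemma wasserstein_comm (μ ν : Measure X) : wasserstein μ ν = wasserstein ν μ :=
  le_antisymm (wasserstein_le_swap ν μ) (wasserstein_le_swap μ ν)

lemma wasserstein_map_le_lintegral {Y : Type*} [MeasurableSpace Y] [SecondCountableTopology X]
    [OpensMeasurableSpace X] (ν : Measure Y) [IsProbabilityMeasure ν] {f g : Y → X}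
    (hf : Measurable f) (hg : Measurable g) :
    wasserstein (ν.map f) (ν.map g) ≤ ∫⁻ y, edist (f y) (g y) ∂ν := by
  have hfg : Measurable fun y => (f y, g y) := hf.prodMk hg
  rw [← lintegral_map measurable_edist hfg]
  exact wasserstein_le_transportCost ⟨Measure.isProbabilityMeasure_map hfg.aemeasurable,
    Measure.map_map measurable_fst hfg, Measure.map_map measurable_snd hfg⟩

lemma wasserstein_map_le {Y : Type*} [MeasurableSpace Y] [SecondCountableTopology X]
    [OpensMeasurableSpace X] (ν : Measure Y) [IsProbabilityMeasure ν] {f g : Y → X}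
    (hf : Measurable f) (hg : Measurable g) {c : ℝ≥0∞} (h : ∀ᵐ y ∂ν, edist (f y) (g y) ≤ c) :
    wasserstein (ν.map f) (ν.map g) ≤ c :=
  (wasserstein_map_le_lintegral ν hf hg).trans ((lintegral_mono_ae h).trans (by simp))

lemma enorm_integral_sub_le_wasserstein {E : Type*} [NormedAddCommGroup E] [NormedSpace ℝ E]
    {μ ν : Measure X} [IsProbabilityMeasure μ] [IsProbabilityMeasure ν] {g : X → E} {K : ℝ≥0}
    {s : Set X} (hg : LipschitzOnWith K g s) (hgμ : Integrable g μ) (hgν : Integrable g ν)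
    (hμ : ∀ᵐ x ∂μ, x ∈ s) (hν : ∀ᵐ x ∂ν, x ∈ s) :
    ‖∫ x, g x ∂μ - ∫ x, g x ∂ν‖ₑ ≤ K * wasserstein μ ν := by
  have := (transferencePlans_nonempty μ ν).to_subtype
  rw [wasserstein, iInf_subtype', ENNReal.mul_iInf fun h => absurd h ENNReal.coe_ne_top]
  refine le_iInf fun ⟨τ, _, hfst, hsnd⟩ => ?_
  subst hfst hsnd
  change _ ≤ (K : ℝ≥0∞) * transportCost τ
  rw [integral_map measurable_fst.aemeasurable hgμ.1,
    integral_map measurable_snd.aemeasurable hgν.1,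
    ← integral_sub (f := fun p : X × X => g p.1) (g := fun p => g p.2)
      (hgμ.comp_measurable measurable_fst) (hgν.comp_measurable measurable_snd),
    transportCost, ← lintegral_const_mul' _ _ ENNReal.coe_ne_top]
  refine (enorm_integral_le_lintegral_enorm _).trans (lintegral_mono_ae ?_)
  filter_upwards [ae_of_ae_map measurable_fst.aemeasurable hμ,
    ae_of_ae_map measurable_snd.aemeasurable hν] with p h₁ h₂
  rw [← edist_eq_enorm_sub]
  exact hg h₁ h₂

end Plans

lemma exists_gluing {X Y Z : Type*} [MeasurableSpace X] [MeasurableSpace Y] [MeasurableSpace Z]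
    [StandardBorelSpace Z] [Nonempty Z] (τ₁ : Measure (X × Y)) (τ₂ : Measure (Y × Z))
    [IsProbabilityMeasure τ₁] [IsFiniteMeasure τ₂] (h : τ₁.snd = τ₂.fst) :
    ∃ σ : Measure ((X × Y) × Z), IsProbabilityMeasure σ ∧ σ.fst = τ₁ ∧
      σ.map (Prod.map Prod.snd id) = τ₂ := by
  let κ := τ₂.condKernel.comap (mγ := inferInstance) (Prod.snd : X × Y → Y) measurable_snd
  refine ⟨τ₁ ⊗ₘ κ, inferInstance, Measure.fst_compProd τ₁ κ, ?_⟩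
  refine Measure.ext_of_lintegral _ fun f hf => ?_
  rw [lintegral_map hf (by fun_prop), Measure.lintegral_compProd (by fun_prop),
    ← τ₂.disintegrate τ₂.condKernel, Measure.lintegral_compProd hf, ← h, Measure.snd,
    lintegral_map hf.lintegral_kernel_prod_right' measurable_snd]
  rfl

lemma wasserstein_triangle {X : Type*} [PseudoEMetricSpace X] [MeasurableSpace X]
    [SecondCountableTopology X] [BorelSpace X] [StandardBorelSpace X] (μ ν ρ : Measure X) :
    wasserstein μ ρ ≤ wasserstein μ ν + wasserstein ν ρ := by
  simp only [wasserstein.eq_1 μ ν, wasserstein.eq_1 ν ρ, ENNReal.iInf_add, ENNReal.add_iInf]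
  refine le_iInf₂ fun τ₂ ⟨_, hν₂, hρ⟩ => le_iInf₂ fun τ₁ ⟨_, hμ, hν₁⟩ => ?_
  have : Nonempty X := τ₁.nonempty_of_neZero.map Prod.fst
  obtain ⟨σ, _, rfl, rfl⟩ := exists_gluing τ₁ τ₂ (hν₁.trans hν₂.symm)
  rw [Measure.map_map (by fun_prop) (by fun_prop)] at hρ
  rw [Measure.fst, Measure.map_map (by fun_prop) (by fun_prop)] at hμ
  calc wasserstein μ ρ ≤ ∫⁻ q, edist q.1.1 q.2 ∂σ := by
        rw [← hμ, ← hρ]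
        exact wasserstein_map_le_lintegral σ (by fun_prop) (by fun_prop)
    _ ≤ ∫⁻ q, edist q.1.1 q.1.2 + edist q.1.2 q.2 ∂σ :=
        lintegral_mono fun q => edist_triangle _ _ _
    _ = transportCost σ.fst + transportCost (σ.map (Prod.map Prod.snd id)) := by
        rw [lintegral_add_left (by fun_prop), transportCost, transportCost, Measure.fst,
          lintegral_map (by fun_prop) (by fun_prop), lintegral_map (by fun_prop) (by fun_prop)]
        rfl

lemma ext_of_wasserstein_eq_zero {X : Type*} [PseudoEMetricSpace X] [MeasurableSpace X]
    [BorelSpace X] {μ ν : Measure X} [IsProbabilityMeasure μ] [IsProbabilityMeasure ν]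
    (h : wasserstein μ ν = 0) : μ = ν := by
  have key : ∀ F : Set X, IsClosed F → μ F = ν F := fun F hF => by
    have hδ : ∀ k : ℕ, (0 : ℝ) < 1 / (k + 1) := fun k => Nat.one_div_pos_of_nat
    have hlim : ∀ ρ : Measure X, [IsProbabilityMeasure ρ] → Tendsto
        (fun k => ∫⁻ x, thickenedIndicator (hδ k) F x ∂ρ) atTop (𝓝 (ρ F)) := fun ρ _ =>
      tendsto_lintegral_thickenedIndicator_of_isClosed ρ hF hδ
        tendsto_one_div_add_atTop_nhds_zero_nat
    refine tendsto_nhds_unique (hlim μ) ((hlim ν).congr fun k => ?_)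
    have hLip := (LipschitzWith.subtype_val _).comp (lipschitzWith_thickenedIndicator (hδ k) F)
    have hle := enorm_integral_sub_le_wasserstein hLip.lipschitzOnWith
      (integrable_thickenedIndicator F (hδ k)) (integrable_thickenedIndicator F (hδ k))
      (ae_of_all μ fun _ => mem_univ _) (ae_of_all ν fun _ => mem_univ _)
    rw [h, mul_zero, nonpos_iff_eq_zero, enorm_eq_zero, sub_eq_zero] at hle
    rw [← ENNReal.toReal_eq_toReal_iff'
      (BoundedContinuousFunction.lintegral_lt_top_of_nnreal _ _).ne
      (BoundedContinuousFunction.lintegral_lt_top_of_nnreal _ _).ne,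
      BoundedContinuousFunction.toReal_lintegral_coe_eq_integral,
      BoundedContinuousFunction.toReal_lintegral_coe_eq_integral]
    exact hle.symm
  refine ext_of_generate_finite _ ?_ isPiSystem_isClosed key (by simp)
  rw [BorelSpace.measurable_eq (α := X), borel_eq_generateFrom_isClosed]

/-- The Borel probability measures on `X`, with the Wasserstein distance as extended metric. A
structure of its own, because `ProbabilityMeasure X` carries the topology of weak convergence. -/
structure WassersteinSpace (X : Type*) [MeasurableSpace X] where
  of ::
  toProbabilityMeasure : ProbabilityMeasure X

namespace WassersteinSpace

variable {X : Type*} [MeasurableSpace X]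

noncomputable instance [EMetricSpace X] [SecondCountableTopology X] [BorelSpace X]
    [StandardBorelSpace X] : EMetricSpace (WassersteinSpace X) where
  edist μ ν := wasserstein (μ.toProbabilityMeasure : Measure X) ν.toProbabilityMeasure
  edist_self μ := by
    simpa using wasserstein_map_le (μ.toProbabilityMeasure : Measure X) measurable_id
      measurable_id (c := 0) (by simp)
  edist_comm _ _ := wasserstein_comm _ _
  edist_triangle _ _ _ := wasserstein_triangle _ _ _
  eq_of_edist_eq_zero {μ ν} h :=
    congrArg of (ProbabilityMeasure.toMeasure_injective (ext_of_wasserstein_eq_zero h))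

end WassersteinSpace

end Wasserstein

section Compactness

section Coupling

variable {X : Type*} [PseudoEMetricSpace X] [MeasurableSpace X] [SecondCountableTopology X]
  [OpensMeasurableSpace X]

lemma wasserstein_add_le (ρ μ ν : Measure X) [IsProbabilityMeasure (ρ + μ)]
    [IsProbabilityMeasure (ρ + ν)] {D : ℝ≥0∞} (hD : ∀ᵐ p ∂μ.prod ν, edist p.1 p.2 ≤ D) :
    wasserstein (ρ + μ) (ρ + ν) ≤ D * μ univ := by
  have : IsFiniteMeasure ρ := isFiniteMeasure_of_le (ρ + μ) (Measure.le_add_right le_rfl)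
  have : IsFiniteMeasure μ := isFiniteMeasure_of_le (ρ + μ) (Measure.le_add_left le_rfl)
  have : IsFiniteMeasure ν := isFiniteMeasure_of_le (ρ + ν) (Measure.le_add_left le_rfl)
  have hmass : μ univ = ν univ := by
    have h : ρ univ + μ univ = ρ univ + ν univ := by
      rw [← Measure.add_apply, ← Measure.add_apply, measure_univ, measure_univ]
    exact (ENNReal.add_right_inj (measure_ne_top ρ univ)).1 h
  have hsmul : ∀ κ : Measure X, κ univ = μ univ → (μ univ)⁻¹ • μ univ • κ = κ := fun κ hκ => by
    rcases eq_or_ne (μ univ) 0 with h | h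
    · rw [Measure.measure_univ_eq_zero.1 (hκ.trans h), smul_zero, smul_zero]
    · rw [smul_smul, ENNReal.inv_mul_cancel h (measure_ne_top μ univ), one_smul]
  have hdiag : Measurable fun x : X => (x, x) := by fun_prop
  -- The common part `ρ` stays in place; the rest moves by the normalized product coupling.
  let τ : Measure (X × X) := ρ.map (fun x => (x, x)) + (μ univ)⁻¹ • μ.prod ν
  have hfst : τ.map Prod.fst = ρ + μ := by
    rw [Measure.map_add _ _ measurable_fst, Measure.map_map measurable_fst hdiag, Measure.map_smul,
      Measure.map_fst_prod, ← hmass, hsmul μ rfl]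
    exact congrArg (· + μ) Measure.map_id
  have hsnd : τ.map Prod.snd = ρ + ν := by
    rw [Measure.map_add _ _ measurable_snd, Measure.map_map measurable_snd hdiag, Measure.map_smul,
      Measure.map_snd_prod, hsmul ν hmass.symm]
    exact congrArg (· + ν) Measure.map_id
  have hτ : IsProbabilityMeasure τ :=
    ⟨by rw [← measure_univ (μ := ρ + μ), ← hfst, Measure.map_apply measurable_fst .univ,
      preimage_univ]⟩
  calc wasserstein (ρ + μ) (ρ + ν) ≤ transportCost τ :=
        wasserstein_le_transportCost ⟨hτ, hfst, hsnd⟩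
    _ = (μ univ)⁻¹ * ∫⁻ p, edist p.1 p.2 ∂μ.prod ν := by
        rw [transportCost, lintegral_add_measure, lintegral_map measurable_edist hdiag,
          lintegral_smul_measure]
        simp
    _ ≤ (μ univ)⁻¹ * ∫⁻ _, D ∂μ.prod ν := mul_le_mul_right (lintegral_mono_ae hD) _
    _ = D * μ univ * ((μ univ)⁻¹ * μ univ) := by
        rw [lintegral_const, ← univ_prod_univ, Measure.prod_prod, ← hmass]; ring
    _ ≤ D * μ univ := mul_le_of_le_one_right' (ENNReal.inv_mul_le_one _)

lemma wasserstein_sum_smul_dirac_le [MeasurableSingletonClass X] {ι : Type*} [Fintype ι]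
    (c : ι → X) {a b : ι → ℝ≥0∞} (ha : ∑ i, a i = 1) (hb : ∑ i, b i = 1) :
    wasserstein (∑ i, a i • Measure.dirac (c i)) (∑ i, b i • Measure.dirac (c i)) ≤
      Metric.ediam (range c) * ∑ i, (a i - b i) := by
  have hmass : ∀ w : ι → ℝ≥0∞, (∑ i, w i • Measure.dirac (c i)) univ = ∑ i, w i := fun w => by
    simp [Measure.finsetSum_apply]
  have hsplit : ∀ w w' : ι → ℝ≥0∞, ∑ i, w i • Measure.dirac (c i) =
      ∑ i, min (w i) (w' i) • Measure.dirac (c i) + ∑ i, (w i - w' i) • Measure.dirac (c i) :=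
    fun w w' => by
      simp_rw [← Finset.sum_add_distrib, ← add_smul, add_comm (min _ _), tsub_add_min]
  have hrange : ∀ w : ι → ℝ≥0∞, ∀ᵐ x ∂∑ i, w i • Measure.dirac (c i), x ∈ range c := fun w => by
    rw [← Measure.sum_fintype, Measure.ae_sum_iff]
    exact fun i => Measure.ae_smul_measure
      ((ae_dirac_iff (finite_range c).measurableSet).2 (mem_range_self i)) _
  have : IsProbabilityMeasure (∑ i, min (a i) (b i) • Measure.dirac (c i) +
    ∑ i, (a i - b i) • Measure.dirac (c i)) := ⟨by rw [← hsplit, hmass, ha]⟩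
  have : IsProbabilityMeasure (∑ i, min (a i) (b i) • Measure.dirac (c i) +
    ∑ i, (b i - a i) • Measure.dirac (c i)) :=
    ⟨by simp_rw [min_comm (a _), ← hsplit, hmass, hb]⟩
  rw [hsplit a b, hsplit b a, ← hmass fun i => a i - b i]
  simp_rw [min_comm (b _)]
  refine wasserstein_add_le _ _ _ ?_
  filter_upwards [Measure.quasiMeasurePreserving_fst.ae (hrange fun i => a i - b i),
    Measure.quasiMeasurePreserving_snd.ae (hrange fun i => b i - a i)] with p h₁ h₂
  exact Metric.edist_le_ediam_of_mem h₁ h₂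

lemma wasserstein_sum_smul_dirac_le_of_edist_le {ι : Type*} [Fintype ι] (μ : ι → Measure X)
    [IsProbabilityMeasure (∑ i, μ i)] (c : ι → X) {ε : ℝ≥0∞}
    (hε : ∀ i, ∀ᵐ x ∂μ i, edist x (c i) ≤ ε) :
    wasserstein (∑ i, μ i) (∑ i, μ i univ • Measure.dirac (c i)) ≤ ε := by
  have hpair : ∀ i, Measurable fun x : X => (x, c i) := fun i => by fun_prop
  let τ : Measure (X × X) := ∑ i, (μ i).map fun x => (x, c i)
  have hfst : τ.map Prod.fst = ∑ i, μ i := by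
    rw [Measure.map_finset_sum measurable_fst.aemeasurable]
    exact Finset.sum_congr rfl fun i _ =>
      (Measure.map_map measurable_fst (hpair i)).trans Measure.map_id
  have hsnd : τ.map Prod.snd = ∑ i, μ i univ • Measure.dirac (c i) := by
    rw [Measure.map_finset_sum measurable_snd.aemeasurable]
    exact Finset.sum_congr rfl fun i _ =>
      (Measure.map_map measurable_snd (hpair i)).trans (Measure.map_const _ _)
  have hτ : IsProbabilityMeasure τ :=
    ⟨by rw [← measure_univ (μ := ∑ i, μ i), ← hfst, Measure.map_apply measurable_fst .univ,
      preimage_univ]⟩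
  calc wasserstein (∑ i, μ i) (∑ i, μ i univ • Measure.dirac (c i))
      ≤ transportCost τ := wasserstein_le_transportCost ⟨hτ, hfst, hsnd⟩
    _ = ∑ i, ∫⁻ x, edist x (c i) ∂μ i := by
        rw [transportCost, lintegral_finsetSum_measure]
        exact Finset.sum_congr rfl fun i _ => lintegral_map measurable_edist (hpair i)
    _ ≤ ∑ i, ε * μ i univ := Finset.sum_le_sum fun i _ =>
        (lintegral_mono_ae (hε i)).trans_eq (lintegral_const ε)
    _ = ε := by rw [← Finset.mul_sum, ← Measure.finsetSum_apply, measure_univ, mul_one]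

end Coupling

lemma exists_partitionOfUnity_edist_le {X : Type*} [MetricSpace X] {K : Set X} (hK : IsCompact K)
    {ε : ℝ≥0∞} (hε : 0 < ε) :
    ∃ (t : Finset X) (φ : PartitionOfUnity t X K), ∀ c x, φ c x ≠ 0 → edist x c ≤ ε := by
  obtain ⟨t, -, hcover⟩ := hK.elim_nhds_subcover (Metric.eball · ε) fun x _ =>
    Metric.eball_mem_nhds x hε
  obtain ⟨φ, hφ⟩ := PartitionOfUnity.exists_isSubordinate_of_locallyFinite hK.isClosed
    (fun c : t => Metric.eball (c : X) ε) (fun _ => Metric.isOpen_eball) (locallyFinite_of_finite _)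
    (hcover.trans (biUnion_eq_iUnion (t : Set X) fun x _ => Metric.eball x ε).subset)
  exact ⟨t, φ, fun c x hx => (hφ c (subset_tsupport _ hx)).le⟩

variable {X : Type*} [MetricSpace X] [MeasurableSpace X] [BorelSpace X] {K : Set X} {ι : Type*}

lemma integrable_partitionOfUnity (φ : PartitionOfUnity ι X K) (i : ι) (μ : Measure X)
    [IsFiniteMeasure μ] : Integrable (φ i) μ :=
  .of_bound (φ i).continuous.aestronglyMeasurable 1 (ae_of_all _ fun x => by
    rw [Real.norm_of_nonneg (φ.nonneg i x)]; exact φ.le_one i x)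

lemma withDensity_partitionOfUnity_univ (φ : PartitionOfUnity ι X K) (i : ι) (μ : Measure X)
    [IsFiniteMeasure μ] :
    μ.withDensity (fun x => ENNReal.ofReal (φ i x)) univ = ENNReal.ofReal (∫ x, φ i x ∂μ) := by
  rw [withDensity_apply _ .univ, Measure.restrict_univ, ofReal_integral_eq_lintegral_ofReal
    (integrable_partitionOfUnity φ i μ) (ae_of_all _ (φ.nonneg i))]

variable [Fintype ι]

/-- The discretization of `μ` by a finite partition of unity `φ` on `K`, which moves the mass
`∫ φ i dμ` to the point `c i`. -/
noncomputable def quantize (φ : PartitionOfUnity ι X K) (c : ι → X) (μ : Measure X) : Measure X :=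
  ∑ i, ENNReal.ofReal (∫ x, φ i x ∂μ) • Measure.dirac (c i)

variable {φ : PartitionOfUnity ι X K} {μ : Measure X}

lemma sum_withDensity_partitionOfUnity (φ : PartitionOfUnity ι X K) (hμ : ∀ᵐ x ∂μ, x ∈ K) :
    ∑ i, μ.withDensity (fun x => ENNReal.ofReal (φ i x)) = μ := by
  have hmeas : ∀ i, Measurable fun x => ENNReal.ofReal (φ i x) := fun i =>
    (φ i).continuous.measurable.ennreal_ofReal
  rw [← Measure.sum_fintype, ← withDensity_tsum hmeas]
  have hone : (∑' i, fun x => ENNReal.ofReal (φ i x)) =ᵐ[μ] 1 := hμ.mono fun x hx => by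
    rw [tsum_fintype, Finset.sum_apply, ← ENNReal.ofReal_sum_of_nonneg fun i _ => φ.nonneg i x,
      ← finsum_eq_sum_of_fintype, φ.sum_eq_one hx, ENNReal.ofReal_one, Pi.one_apply]
  rw [withDensity_congr_ae hone, withDensity_one]

variable [IsProbabilityMeasure μ]

lemma sum_ofReal_integral_partitionOfUnity (φ : PartitionOfUnity ι X K) (hμ : ∀ᵐ x ∂μ, x ∈ K) :
    ∑ i, ENNReal.ofReal (∫ x, φ i x ∂μ) = 1 := by
  simp_rw [← withDensity_partitionOfUnity_univ, ← Measure.finsetSum_apply,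
    sum_withDensity_partitionOfUnity φ hμ, measure_univ]

variable [SecondCountableTopology X]

lemma wasserstein_quantize_le {c : ι → X} (hμ : ∀ᵐ x ∂μ, x ∈ K) {ε : ℝ≥0∞}
    (hε : ∀ i x, φ i x ≠ 0 → edist x (c i) ≤ ε) : wasserstein μ (quantize φ c μ) ≤ ε := by
  have hsum := sum_withDensity_partitionOfUnity φ hμ
  have : IsProbabilityMeasure (∑ i, μ.withDensity (fun x => ENNReal.ofReal (φ i x))) := by
    rw [hsum]; infer_instance
  have h := wasserstein_sum_smul_dirac_le_of_edist_le
    (fun i => μ.withDensity fun x => ENNReal.ofReal (φ i x)) c fun i =>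
      (ae_withDensity_iff (φ i).continuous.measurable.ennreal_ofReal).2 <| ae_of_all _ fun x hx =>
        hε i x fun h0 => hx (by rw [h0, ENNReal.ofReal_zero])
  simpa only [hsum, withDensity_partitionOfUnity_univ, quantize] using h

lemma tendsto_wasserstein_quantize {c : ι → X} {α : Type*} {l : Filter α}
    {μs : α → ProbabilityMeasure X} {μ : ProbabilityMeasure X} (h : Tendsto μs l (𝓝 μ))
    (hμs : ∀ᶠ a in l, ∀ᵐ x ∂(μs a : Measure X), x ∈ K) (hμ : ∀ᵐ x ∂(μ : Measure X), x ∈ K) :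
    Tendsto (fun a => wasserstein (quantize φ c (μs a : Measure X)) (quantize φ c μ)) l (𝓝 0) := by
  have hmass : ∀ i, Tendsto (fun a => ENNReal.ofReal (∫ x, φ i x ∂(μs a : Measure X)) -
      ENNReal.ofReal (∫ x, φ i x ∂(μ : Measure X))) l (𝓝 0) := fun i => by
    have hint : Tendsto (fun a => ∫ x, φ i x ∂(μs a : Measure X)) l
        (𝓝 (∫ x, φ i x ∂(μ : Measure X))) :=
      ProbabilityMeasure.tendsto_iff_forall_integral_tendsto.1 h
        (BoundedContinuousFunction.ofNormedAddCommGroup (φ i) (φ i).continuous 1 fun x => by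
          rw [Real.norm_of_nonneg (φ.nonneg i x)]; exact φ.le_one i x)
    have hsub := ENNReal.Tendsto.sub (ENNReal.tendsto_ofReal hint)
      (tendsto_const_nhds (x := ENNReal.ofReal (∫ x, φ i x ∂(μ : Measure X))))
      (.inr ENNReal.ofReal_ne_top)
    rwa [tsub_self] at hsub
  have hlim := ENNReal.Tendsto.const_mul (a := Metric.ediam (range c))
    (tendsto_finsetSum Finset.univ fun i _ => hmass i)
    (.inr (finite_range c).isBounded.ediam_ne_top)
  rw [Finset.sum_const_zero, mul_zero] at hlim
  refine tendsto_of_tendsto_of_tendsto_of_le_of_le' tendsto_const_nhds hlim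
    (.of_forall fun _ => bot_le) (hμs.mono fun a ha => ?_)
  exact wasserstein_sum_smul_dirac_le c (sum_ofReal_integral_partitionOfUnity φ ha)
    (sum_ofReal_integral_partitionOfUnity φ hμ)

variable [StandardBorelSpace X]

lemma WassersteinSpace.tendsto_of_tendsto {α : Type*} {l : Filter α} (hK : IsCompact K)
    {μs : α → ProbabilityMeasure X} {μ : ProbabilityMeasure X} (h : Tendsto μs l (𝓝 μ))
    (hμs : ∀ᶠ a in l, ∀ᵐ x ∂(μs a : Measure X), x ∈ K) (hμ : ∀ᵐ x ∂(μ : Measure X), x ∈ K) :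
    Tendsto (fun a => of (μs a)) l (𝓝 (of μ)) := by
  refine tendsto_iff_edist_tendsto_0.2 <| ENNReal.tendsto_nhds_zero.2 fun ε hε => ?_
  have hε3 : 0 < ε / 3 := ENNReal.div_pos hε.ne' (by norm_num)
  obtain ⟨t, φ, hφ⟩ := exists_partitionOfUnity_edist_le hK hε3
  have hquant := tendsto_wasserstein_quantize (φ := φ) (c := (↑)) h hμs hμ
  filter_upwards [hμs, hquant.eventually_le_const hε3] with a ha hle
  calc wasserstein (μs a : Measure X) μ
      ≤ wasserstein (μs a : Measure X) (quantize φ (↑) (μs a : Measure X)) +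
          (wasserstein (quantize φ (↑) (μs a : Measure X)) (quantize φ (↑) (μ : Measure X)) +
            wasserstein (quantize φ (↑) (μ : Measure X)) μ) :=
        (wasserstein_triangle _ _ _).trans (by gcongr; exact wasserstein_triangle _ _ _)
    _ ≤ ε / 3 + (ε / 3 + ε / 3) := by
        gcongr
        · exact wasserstein_quantize_le ha hφ
        · exact (wasserstein_comm _ _).trans_le (wasserstein_quantize_le hμ hφ)
    _ = ε := by rw [← add_assoc, ENNReal.add_thirds]

namespace WassersteinSpace

/-- The probability measures that give full mass to `K`. -/
def concentratedOn (K : Set X) : Set (WassersteinSpace X) :=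
  {μ | ∀ᵐ x ∂(μ.toProbabilityMeasure : Measure X), x ∈ K}

lemma isCompact_concentratedOn (hK : IsCompact K) : IsCompact (concentratedOn K) := by
  have hweak : IsCompact {μ : ProbabilityMeasure X | ∀ᵐ x ∂(μ : Measure X), x ∈ K} := by
    have := isCompact_setOfPred_probabilityMeasure_mass_eq_compl_isCompact_le (E := X)
      (u := fun _ => 0) (K := fun _ => K) tendsto_const_nhds (fun _ => hK) (.inr monotone_const)
    convert this using 3
    simp only [forall_const, nonpos_iff_eq_zero, ProbabilityMeasure.null_iff_toMeasure_null]
    rfl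
  have himage : concentratedOn K = of '' {μ | ∀ᵐ x ∂(μ : Measure X), x ∈ K} :=
    ext fun μ => ⟨fun hμ => ⟨μ.toProbabilityMeasure, hμ, rfl⟩, fun ⟨_, hν, h⟩ => h ▸ hν⟩
  rw [himage]
  exact hweak.image_of_continuousOn fun μ hμ => tendsto_of_tendsto hK (μs := id)
    (tendsto_id'.2 nhdsWithin_le_nhds) self_mem_nhdsWithin hμ

end WassersteinSpace

end Compactness

section UniformLimits

lemma exists_subseq_tendsto_iSup_edist {α Y : Type*} [PseudoEMetricSpace α] [PseudoEMetricSpace Y]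
    [CompactSpace α] {K : Set Y} (hK : IsCompact K) {L : ℝ≥0} {u : ℕ → α → Y}
    (hmem : ∀ k x, u k x ∈ K) (hlip : ∀ k, LipschitzWith L (u k)) :
    ∃ (v : α → Y) (φ : ℕ → ℕ), StrictMono φ ∧
      Tendsto (fun k => ⨆ x, edist (u (φ k) x) (v x)) atTop (𝓝 0) := by
  obtain ⟨v, -, hv⟩ := (isCompact_univ_pi fun _ : α => hK).ultrafilter_le_nhds
    ((hyperfilter ℕ).map u) (tendsto_principal.2 (.of_forall fun k x _ => hmem k x))
  have hcluster : MapClusterPt (UniformFun.ofFun v) atTop (UniformFun.ofFun ∘ u) :=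
    (((LipschitzWith.uniformEquicontinuous u L hlip).equicontinuous.tendsto_uniformFun_iff_pi
      _ v).2 hv).mapClusterPt.mono Nat.hyperfilter_le_atTop
  obtain ⟨φ, hφ, hlim⟩ := hcluster.tendsto_subseq
  refine ⟨v, φ, hφ, ?_⟩
  simpa only [UniformFun.edist_def] using! tendsto_iff_edist_tendsto_0.1 hlim

lemma lipschitzOnWith_of_Iic_of_Ici {Y : Type*} [PseudoEMetricSpace Y] {g : ℝ → Y} {L : ℝ≥0}
    {S : Set ℝ} (hS : S.OrdConnected) {c : ℝ} (hle : LipschitzOnWith L g (S ∩ Iic c))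
    (hge : LipschitzOnWith L g (S ∩ Ici c)) : LipschitzOnWith L g S := by
  have hsplit : ∀ x ∈ S, ∀ y ∈ S, x ≤ c → c ≤ y → edist (g x) (g y) ≤ L * edist x y :=
    fun x hx y hy hxc hcy => by
      have hc : c ∈ S := hS.out hx hy ⟨hxc, hcy⟩
      calc edist (g x) (g y) ≤ L * edist x c + L * edist c y :=
            (edist_triangle _ (g c) _).trans
              (add_le_add (hle ⟨hx, hxc⟩ ⟨hc, self_mem_Iic⟩) (hge ⟨hc, self_mem_Ici⟩ ⟨hy, hcy⟩))
        _ = L * edist x y := by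
            rw [← mul_add, edist_comm x c, edist_comm x y]
            simp_rw [edist_dist, Real.dist_eq]
            rw [← ENNReal.ofReal_add (abs_nonneg _) (abs_nonneg _), abs_of_nonneg (by linarith),
              abs_of_nonpos (by linarith), abs_of_nonneg (by linarith)]
            ring_nf
  intro x hx y hy
  rcases le_total x c with hxc | hcx <;> rcases le_total y c with hyc | hcy
  · exact hle ⟨hx, hxc⟩ ⟨hy, hyc⟩
  · exact hsplit x hx y hy hxc hcy
  · rw [edist_comm (g x), edist_comm x]
    exact hsplit y hy x hx hyc hcx
  · exact hge ⟨hx, hcx⟩ ⟨hy, hcy⟩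

lemma lipschitzOnWith_of_grid {Y : Type*} [PseudoEMetricSpace Y] {g : ℝ → Y} {L : ℝ≥0}
    {S : Set ℝ} (hS : S.OrdConnected) (hS₀ : S ⊆ Ici 0) {τ : ℝ} (hτ : 0 < τ)
    (h : ∀ ℓ : ℕ, LipschitzOnWith L g (S ∩ Icc (ℓ * τ) ((ℓ + 1) * τ))) :
    LipschitzOnWith L g S := by
  have hIic : ∀ ℓ : ℕ, LipschitzOnWith L g (S ∩ Iic (ℓ * τ)) := fun ℓ => by
    induction ℓ with
    | zero =>
      refine (h 0).mono fun x ⟨hx, hx0⟩ => ⟨hx, ?_⟩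
      have hx₀ : 0 ≤ x := hS₀ hx
      simp only [CharP.cast_eq_zero, zero_mul, mem_Iic, mem_Icc] at hx0 ⊢
      exact ⟨hx₀, by linarith⟩
    | succ ℓ ih =>
      refine lipschitzOnWith_of_Iic_of_Ici (c := ℓ * τ) (hS.inter ordConnected_Iic)
        (ih.mono fun x hx => ⟨hx.1.1, hx.2⟩) ((h ℓ).mono fun x hx => ⟨hx.1.1, hx.2, ?_⟩)
      simpa using hx.1.2
  intro x hx y hy
  obtain ⟨ℓ, hℓ⟩ := exists_nat_ge (max x y / τ)
  rw [div_le_iff₀ hτ] at hℓ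
  exact hIic ℓ ⟨hx, (le_max_left x y).trans hℓ⟩ ⟨hy, (le_max_right x y).trans hℓ⟩

end UniformLimits

section Lattice

variable {n : ℕ} {h : ℝ}

/-- The index of the half-open cube of side `h` that contains `y`. -/
noncomputable def cellIndex (h : ℝ) (y : Space n) : Fin n → ℤ := fun k => ⌊y k / h⌋

/-- The corner of the half-open cube of side `h` that contains `y`; this is the rounding done by
the lattice approximate solutions. -/
noncomputable def roundDown (h : ℝ) (y : Space n) : Space n := latticePoint h (cellIndex h y)

lemma measurable_cellIndex (h : ℝ) : Measurable (cellIndex (n := n) h) :=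
  measurable_pi_lambda _ fun _ => Int.measurable_floor.comp (by fun_prop)

lemma measurable_roundDown (h : ℝ) : Measurable (roundDown (n := n) h) :=
  (measurable_of_countable (latticePoint h)).comp (measurable_cellIndex h)

lemma mem_latticeCell_iff (hh : 0 < h) {z : Fin n → ℤ} {y : Space n} :
    y ∈ latticeCell h z ↔ cellIndex h y = z := by
  rw [funext_iff]
  refine forall_congr' fun k => ?_
  rw [cellIndex, Int.floor_eq_iff, le_div_iff₀ hh, div_lt_iff₀ hh, mul_comm h, add_mul, one_mul]

lemma measurableSet_latticeCell (hh : 0 < h) (z : Fin n → ℤ) :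
    MeasurableSet (latticeCell h z) :=
  Set.ext (fun _ => mem_latticeCell_iff hh) ▸ measurable_cellIndex h (measurableSet_singleton z)

lemma cellIndex_latticePoint (hh : 0 < h) (z : Fin n → ℤ) :
    cellIndex h (latticePoint h z) = z :=
  funext fun k => by simp [cellIndex, latticePoint, mul_div_cancel_left₀ _ hh.ne']

lemma norm_sub_roundDown_le (hh : 0 < h) (y : Space n) : ‖y - roundDown h y‖ ≤ √n * h := by
  have hcoord : ∀ k, ‖(y - roundDown h y) k‖ ^ 2 ≤ h ^ 2 := fun k => by
    obtain ⟨hle, hlt⟩ := (mem_latticeCell_iff hh).2 (rfl : cellIndex h y = cellIndex h y) k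
    have hk : (y - roundDown h y) k = y k - h * cellIndex h y k := rfl
    gcongr
    rw [hk, Real.norm_of_nonneg (by linarith)]
    linarith
  rw [EuclideanSpace.norm_eq]
  calc √(∑ k, ‖(y - roundDown h y) k‖ ^ 2) ≤ √(∑ _k : Fin n, h ^ 2) :=
        Real.sqrt_le_sqrt (Finset.sum_le_sum fun k _ => hcoord k)
    _ = √n * h := by
        rw [Finset.sum_const, Finset.card_univ, Fintype.card_fin, nsmul_eq_mul,
          Real.sqrt_mul (Nat.cast_nonneg _), Real.sqrt_sq hh.le]

lemma norm_roundDown_le (hh : 0 < h) (y : Space n) : ‖roundDown h y‖ ≤ ‖y‖ + √n * h := by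
  have hsub := norm_sub_roundDown_le hh y
  have htri := norm_sub_norm_le (roundDown h y) y
  rw [norm_sub_rev] at htri
  linarith

lemma cellIndex_mem_piFinset (hh : 0 < h) {M : ℤ} {y : Space n} (hy : ‖y‖ ≤ M * h) :
    cellIndex h y ∈ Fintype.piFinset fun _ : Fin n => Finset.Icc (-M) M := by
  refine Fintype.mem_piFinset.2 fun k => Finset.mem_Icc.2 ?_
  obtain ⟨hlow, hhigh⟩ := abs_le.1 ((PiLp.norm_apply_le y k).trans hy)
  constructor
  · refine Int.le_floor.2 ((le_div_iff₀ hh).2 ?_)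
    push_cast
    linarith
  · exact Int.cast_le.1 ((Int.floor_le (y k / h)).trans ((div_le_iff₀ hh).2 hhigh))

variable {N : ℕ}

lemma timeStep_pos (hN : 0 < N) : 0 < timeStep N := by
  unfold timeStep; positivity

lemma spaceStep_pos (hN : 0 < N) : 0 < spaceStep N := by
  unfold spaceStep; positivity

lemma cellIndex_mem_spaceIndices (hN : 0 < N) {y : Space n} (hy : ‖y‖ ≤ N) :
    cellIndex (spaceStep N) y ∈ spaceIndices n N := by
  refine cellIndex_mem_piFinset (spaceStep_pos hN) (hy.trans_eq ?_)
  have : (N : ℝ) ≠ 0 := by positivity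
  rw [spaceStep]; push_cast; field_simp

lemma cellIndex_mem_velIndices (hN : 0 < N) {y : Space n} (hy : ‖y‖ ≤ N) :
    cellIndex (timeStep N) y ∈ velIndices n N := by
  refine cellIndex_mem_piFinset (timeStep_pos hN) (hy.trans_eq ?_)
  have : (N : ℝ) ≠ 0 := by positivity
  rw [timeStep]; push_cast; field_simp

end Lattice

lemma map_eq_sum_smul_dirac {Y X ι : Type*} [MeasurableSpace Y] [MeasurableSpace X]
    {ν : Measure Y} {s : Finset ι} {A : ι → Set Y} {f : Y → X} {c : ι → X}
    (hA : ∀ i ∈ s, MeasurableSet (A i)) (hf : AEMeasurable f ν)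
    (h : ∀ᵐ y ∂ν, ∃ i ∈ s, (∀ j ∈ s, y ∈ A j ↔ j = i) ∧ f y = c i) :
    ν.map f = ∑ i ∈ s, ν (A i) • Measure.dirac (c i) := by
  classical
  ext B hB
  calc ν.map f B = ∫⁻ y, B.indicator 1 (f y) ∂ν := by
        rw [← lintegral_map' (measurable_one.indicator hB).aemeasurable hf,
          lintegral_indicator_one hB]
    _ = ∫⁻ y, ∑ i ∈ s, (A i).indicator (fun _ => B.indicator 1 (c i)) y ∂ν := by
        refine lintegral_congr_ae ?_
        filter_upwards [h] with y ⟨i, hi, hij, hfy⟩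
        rw [Finset.sum_eq_single_of_mem i hi fun j hj hne =>
          indicator_of_notMem (fun hy => hne ((hij j hj).1 hy)) _,
          indicator_of_mem ((hij i hi).2 rfl), hfy]
    _ = ∑ i ∈ s, ν (A i) * B.indicator 1 (c i) := by
        rw [lintegral_finsetSum' _ fun i hi =>
          (measurable_const.indicator (hA i hi)).aemeasurable]
        refine Finset.sum_congr rfl fun i hi => ?_
        rw [lintegral_indicator_const (hA i hi), mul_comm]
    _ = (∑ i ∈ s, ν (A i) • Measure.dirac (c i)) B := by
        rw [Measure.finsetSum_apply]
        refine Finset.sum_congr rfl fun i _ => ?_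
        rw [Measure.smul_apply, Measure.dirac_apply' _ hB, smul_eq_mul]

section Discretization

variable {n N : ℕ}

lemma discSpace_eq_map (hN : 0 < N) {μ : Measure (Space n)} (h : ∀ᵐ x ∂μ, ‖x‖ ≤ N) :
    discSpace N μ = μ.map (roundDown (spaceStep N)) := by
  have hs := spaceStep_pos hN
  refine (map_eq_sum_smul_dirac (fun i _ => measurableSet_latticeCell hs i)
    (measurable_roundDown _).aemeasurable ?_).symm
  filter_upwards [h] with x hx
  refine ⟨_, cellIndex_mem_spaceIndices hN hx, fun j _ => ?_, rfl⟩
  rw [mem_latticeCell_iff hs, eq_comm]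

/-- The motion during the time `h` along the rounded velocities. -/
noncomputable def move (N : ℕ) (h : ℝ) (p : TSpace n) : Space n :=
  p.fst + h • roundDown (timeStep N) p.snd

lemma measurable_move (N : ℕ) (h : ℝ) : Measurable (move (n := n) N h) := by
  have hvel : Measurable fun p : TSpace n => roundDown (timeStep N) p.snd :=
    (measurable_roundDown _).comp (by fun_prop)
  unfold move
  fun_prop

lemma norm_move_le (hN : 0 < N) {h : ℝ} (hh : 0 ≤ h) (p : TSpace n) :
    ‖move N h p‖ ≤ ‖p.fst‖ + h * (‖p.snd‖ + √n * timeStep N) := by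
  refine (norm_add_le _ _).trans ?_
  rw [norm_smul, Real.norm_of_nonneg hh]
  gcongr
  exact norm_roundDown_le (timeStep_pos hN) _

lemma move_mem_range_latticePoint (hN : 0 < N) {p : TSpace n}
    (hp : p.fst ∈ range (latticePoint (spaceStep N))) :
    move N (timeStep N) p ∈ range (latticePoint (spaceStep N)) := by
  obtain ⟨z, hz⟩ := hp
  refine ⟨z + cellIndex (timeStep N) p.snd, ?_⟩
  rw [move, ← hz]
  ext k
  have : (N : ℝ) ≠ 0 := by positivity
  simp only [latticePoint, spaceStep, Pi.add_apply, Int.cast_add, timeStep, roundDown,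
    PiLp.add_apply, PiLp.smul_apply, smul_eq_mul]
  field_simp

namespace PVF

lemma ae_fst (V : PVF n) {P : ProbabilityMeasure (Space n)} {q : Space n → Prop}
    (h : ∀ᵐ x ∂(P : Measure (Space n)), q x) : ∀ᵐ p ∂(V P : Measure (TSpace n)), q p.fst := by
  rw [← V.map_fst P] at h
  exact ae_of_ae_map (by fun_prop) h

lemma onMeasure_coe (V : PVF n) (P : ProbabilityMeasure (Space n)) :
    V.onMeasure (P : Measure (Space n)) = V P :=
  dif_pos (inferInstance : IsProbabilityMeasure (P : Measure (Space n)))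

end PVF

lemma lasMove_eq_map (V : PVF n) (hN : 0 < N) {P : ProbabilityMeasure (Space n)}
    (hP : ∀ᵐ x ∂(P : Measure (Space n)), ‖x‖ ≤ N)
    (hlattice : ∀ᵐ x ∂(P : Measure (Space n)), x ∈ range (latticePoint (spaceStep N)))
    (hv : ∀ᵐ p ∂(V P : Measure (TSpace n)), ‖p.snd‖ ≤ N) (h : ℝ) :
    lasMove V N (P : Measure (Space n)) h = (V P : Measure (TSpace n)).map (move N h) := by
  have hs := spaceStep_pos hN
  have ht := timeStep_pos hN
  have hfst : Measurable fun p : TSpace n => p.fst := by fun_prop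
  have hsnd : Measurable fun p : TSpace n => p.snd := by fun_prop
  simp only [lasMove, ← Finset.sum_product', velMass, V.onMeasure_coe]
  refine (map_eq_sum_smul_dirac (s := spaceIndices n N ×ˢ velIndices n N)
    (A := fun i => {p : TSpace n | p.fst = latticePoint (spaceStep N) i.1 ∧
      p.snd ∈ latticeCell (timeStep N) i.2})
    (fun i _ => (hfst (measurableSet_singleton _)).inter (hsnd (measurableSet_latticeCell ht _)))
    (measurable_move N h).aemeasurable ?_).symm
  filter_upwards [V.ae_fst hP, V.ae_fst hlattice, hv] with p hp ⟨z, hz⟩ hpv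
  have hzi : cellIndex (spaceStep N) p.fst = z := by rw [← hz, cellIndex_latticePoint hs]
  refine ⟨(z, cellIndex (timeStep N) p.snd), Finset.mem_product.2
    ⟨hzi ▸ cellIndex_mem_spaceIndices hN hp, cellIndex_mem_velIndices hN hpv⟩, fun j _ => ?_, ?_⟩
  · rw [mem_latticeCell_iff ht, Prod.ext_iff]
    refine and_congr ⟨fun hj => ?_, fun hj => ?_⟩ eq_comm
    · rw [← hzi, hj, cellIndex_latticePoint hs]
    · rw [← hz, hj]
  · rw [move, hz, roundDown]

end Discretization

section Support

variable {n : ℕ} {P : ProbabilityMeasure (Space n)} {r : ℝ}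

lemma ae_norm_le_iff_support_subset :
    (∀ᵐ x ∂(P : Measure (Space n)), ‖x‖ ≤ r) ↔
      (P : Measure (Space n)).support ⊆ Metric.closedBall 0 r := by
  refine ⟨fun h => Measure.support_subset_of_isClosed Metric.isClosed_closedBall ?_, fun h => ?_⟩
  · filter_upwards [h] with x hx
    exact mem_closedBall_zero_iff.2 hx
  · filter_upwards [Measure.support_mem_ae (μ := (P : Measure (Space n)))] with x hx
    exact mem_closedBall_zero_iff.1 (h hx)

lemma hasCompactSupp_of_ae_norm_le (h : ∀ᵐ x ∂(P : Measure (Space n)), ‖x‖ ≤ r) :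
    HasCompactSupp P :=
  (isCompact_closedBall 0 r).of_isClosed_subset Measure.isClosed_support
    (ae_norm_le_iff_support_subset.1 h)

lemma PVF.SupportSublinear.ae_norm_snd_le {V : PVF n} {C : ℝ} (hV : V.SupportSublinear C)
    (hC : 0 ≤ C) (hr : 0 ≤ r) (h : ∀ᵐ x ∂(P : Measure (Space n)), ‖x‖ ≤ r) :
    ∀ᵐ p ∂(V P : Measure (TSpace n)), ‖p.snd‖ ≤ C * (1 + r) := by
  have hsup : ⨆ x ∈ (P : Measure (Space n)).support, ‖x‖ₑ ≤ ENNReal.ofReal r :=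
    iSup₂_le fun x hx => by
      rw [← ofReal_norm]
      exact ENNReal.ofReal_le_ofReal
        (mem_closedBall_zero_iff.1 (ae_norm_le_iff_support_subset.1 h hx))
  filter_upwards [Measure.support_mem_ae (μ := (V P : Measure (TSpace n)))] with p hp
  have hle : ‖p.snd‖ₑ ≤ ENNReal.ofReal C * (1 + ENNReal.ofReal r) :=
    (le_iSup₂ (f := fun (p : TSpace n) (_ : p ∈ (V P : Measure (TSpace n)).support) => ‖p.snd‖ₑ)
      p hp).trans ((hV P (hasCompactSupp_of_ae_norm_le h)).trans (by gcongr))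
  rw [← ENNReal.ofReal_one, ← ENNReal.ofReal_add zero_le_one hr, ← ENNReal.ofReal_mul hC,
    ← ofReal_norm] at hle
  exact (ENNReal.ofReal_le_ofReal_iff (by positivity)).1 hle

end Support

section Approximants

variable {n N : ℕ} {V : PVF n} {μ₀ : ProbabilityMeasure (Space n)} {T A B C R : ℝ}

/-- The bound `√n/N` for the errors made by rounding velocities to the velocity lattice. -/
noncomputable def roundingError (n N : ℕ) : ℝ := √n * timeStep N

lemma timeStep_nonneg (N : ℕ) : 0 ≤ timeStep N := by
  unfold timeStep; positivity

lemma mul_timeStep (hN : 0 < N) : N * timeStep N = 1 :=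
  mul_one_div_cancel (by positivity)

lemma timeStep_le_one (N : ℕ) : timeStep N ≤ 1 := by
  simpa only [timeStep, one_div] using Nat.cast_inv_le_one N

lemma spaceStep_le_timeStep (N : ℕ) : spaceStep N ≤ timeStep N := by
  rw [spaceStep, ← one_div_pow]
  exact pow_le_of_le_one (timeStep_nonneg N) (timeStep_le_one N) two_ne_zero

lemma roundingError_nonneg (n N : ℕ) : 0 ≤ roundingError n N :=
  mul_nonneg (Real.sqrt_nonneg _) (timeStep_nonneg N)

lemma floor_mul_timeStep_le (hN : 0 < N) {t : ℝ} (ht : 0 ≤ t) :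
    ⌊N * t⌋₊ * timeStep N ≤ t := by
  calc ⌊N * t⌋₊ * timeStep N ≤ N * t * timeStep N :=
        mul_le_mul_of_nonneg_right (Nat.floor_le (by positivity)) (timeStep_nonneg N)
    _ = t := by rw [mul_right_comm, mul_timeStep hN, one_mul]

lemma sub_floor_mul_timeStep_le (hN : 0 < N) (t : ℝ) :
    t - ⌊N * t⌋₊ * timeStep N ≤ timeStep N := by
  have hτ := mul_le_mul_of_nonneg_right (Nat.lt_floor_add_one (N * t)).le (timeStep_nonneg N)
  rw [mul_right_comm, mul_timeStep hN] at hτ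
  linarith

namespace PVF

/-- The measure reached from `μ` when the mass of `V[μ]` moves during the time `h` along the
rounded velocities; in contrast to `lasMove` no mass is truncated. -/
noncomputable def push (V : PVF n) (N : ℕ) (h : ℝ) (μ : ProbabilityMeasure (Space n)) :
    ProbabilityMeasure (Space n) :=
  (V μ).map (measurable_move N h).aemeasurable

lemma coe_push (V : PVF n) (N : ℕ) (h : ℝ) (μ : ProbabilityMeasure (Space n)) :
    (V.push N h μ : Measure (Space n)) = (V μ : Measure (TSpace n)).map (move N h) := rfl

lemma push_zero (V : PVF n) (N : ℕ) (μ : ProbabilityMeasure (Space n)) : V.push N 0 μ = μ := by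
  have hmove : move (n := n) N 0 = fun p => p.fst := funext fun p => by simp [move]
  exact Subtype.ext ((V.coe_push N 0 μ).trans (hmove ▸ V.map_fst μ))

lemma ae_push_iff {h : ℝ} {μ : ProbabilityMeasure (Space n)} {q : Space n → Prop}
    (hq : MeasurableSet {x | q x}) : (∀ᵐ x ∂(V.push N h μ : Measure (Space n)), q x) ↔
      ∀ᵐ p ∂(V μ : Measure (TSpace n)), q (move N h p) :=
  ae_map_iff (measurable_move N h).aemeasurable hq

end PVF

/-- The lattice approximate solution at the time `ℓ/N` without truncation to `[-N,N]ⁿ`, which is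
always a probability measure. -/
noncomputable def gridCurve (V : PVF n) (N : ℕ) (μ₀ : ProbabilityMeasure (Space n)) :
    ℕ → ProbabilityMeasure (Space n)
  | 0 => μ₀.map (measurable_roundDown (spaceStep N)).aemeasurable
  | ℓ + 1 => V.push N (timeStep N) (gridCurve V N μ₀ ℓ)

/-- The lattice approximate solution at the time `t ≥ 0` without truncation to `[-N,N]ⁿ`. -/
noncomputable def stepCurve (V : PVF n) (N : ℕ) (μ₀ : ProbabilityMeasure (Space n)) (t : ℝ) :
    ProbabilityMeasure (Space n) :=
  V.push N (t - ⌊N * t⌋₊ * timeStep N) (gridCurve V N μ₀ ⌊N * t⌋₊)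

lemma stepCurve_add (V : PVF n) (μ₀ : ProbabilityMeasure (Space n)) (hN : 0 < N) (ℓ : ℕ) {h : ℝ}
    (h₀ : 0 ≤ h) (hτ : h ≤ timeStep N) :
    stepCurve V N μ₀ (ℓ * timeStep N + h) = V.push N h (gridCurve V N μ₀ ℓ) := by
  have hopen : ∀ (ℓ : ℕ) {h : ℝ}, 0 ≤ h → h < timeStep N →
      stepCurve V N μ₀ (ℓ * timeStep N + h) = V.push N h (gridCurve V N μ₀ ℓ) := by
    intro ℓ h h₀ hτ
    have hfloor : ⌊N * (ℓ * timeStep N + h)⌋₊ = ℓ := by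
      rw [mul_add, mul_left_comm, mul_timeStep hN, mul_one, Nat.floor_eq_iff (by positivity)]
      refine ⟨le_add_of_nonneg_right (by positivity), add_lt_add_right ?_ _⟩
      rw [← mul_timeStep hN]
      gcongr
    rw [stepCurve, hfloor, add_sub_cancel_left]
  rcases hτ.lt_or_eq with hlt | rfl
  · exact hopen ℓ h₀ hlt
  · have hnext := hopen (ℓ + 1) le_rfl (timeStep_pos hN)
    rw [V.push_zero, add_zero] at hnext
    rwa [← add_one_mul, ← Nat.cast_add_one]

lemma stepCurve_mul_timeStep (V : PVF n) (μ₀ : ProbabilityMeasure (Space n)) (hN : 0 < N)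
    (ℓ : ℕ) : stepCurve V N μ₀ (ℓ * timeStep N) = gridCurve V N μ₀ ℓ := by
  simpa only [add_zero, V.push_zero] using stepCurve_add V μ₀ hN ℓ le_rfl (timeStep_nonneg N)

lemma ae_gridCurve_zero_iff {q : Space n → Prop} (hq : MeasurableSet {x | q x}) :
    (∀ᵐ x ∂(gridCurve V N μ₀ 0 : Measure (Space n)), q x) ↔
      ∀ᵐ x ∂(μ₀ : Measure (Space n)), q (roundDown (spaceStep N) x) :=
  ae_map_iff (measurable_roundDown _).aemeasurable hq

lemma norm_sub_roundDown_spaceStep_le (hN : 0 < N) (x : Space n) :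
    ‖x - roundDown (spaceStep N) x‖ ≤ roundingError n N :=
  (norm_sub_roundDown_le (spaceStep_pos hN) x).trans
    (mul_le_mul_of_nonneg_left (spaceStep_le_timeStep N) (Real.sqrt_nonneg _))

lemma wasserstein_stepCurve_zero_le (V : PVF n) (μ₀ : ProbabilityMeasure (Space n)) (hN : 0 < N) :
    wasserstein (stepCurve V N μ₀ 0 : Measure (Space n)) μ₀ ≤
      ENNReal.ofReal (roundingError n N) := by
  have hzero := stepCurve_mul_timeStep V μ₀ hN 0
  rw [Nat.cast_zero, zero_mul] at hzero
  have h := wasserstein_map_le (μ₀ : Measure (Space n)) (measurable_roundDown (spaceStep N))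
    measurable_id (c := ENNReal.ofReal (roundingError n N)) (ae_of_all _ fun x => by
      rw [edist_comm, edist_dist, dist_eq_norm]
      exact ENNReal.ofReal_le_ofReal (norm_sub_roundDown_spaceStep_le hN x))
  rw [Measure.map_id] at h
  rwa [hzero]

lemma ae_mem_range_latticePoint_gridCurve (V : PVF n) (μ₀ : ProbabilityMeasure (Space n))
    (hN : 0 < N) (ℓ : ℕ) : ∀ᵐ x ∂(gridCurve V N μ₀ ℓ : Measure (Space n)),
      x ∈ range (latticePoint (spaceStep N)) := by
  have hmeas : MeasurableSet (range (latticePoint (n := n) (spaceStep N))) :=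
    (countable_range _).measurableSet
  induction ℓ with
  | zero => exact (ae_gridCurve_zero_iff hmeas).2 (ae_of_all _ fun x => mem_range_self _)
  | succ ℓ ih =>
    exact (PVF.ae_push_iff hmeas).2
      ((V.ae_fst ih).mono fun _ hp => move_mem_range_latticePoint hN hp)

/-- Bounds for the untruncated lattice approximate solution on `[0,T]`: on the time grid, `A`
bounds the positions and `B` the velocities including their rounding errors. -/
structure IsGridBound (V : PVF n) (N : ℕ) (μ₀ : ProbabilityMeasure (Space n)) (T A B : ℝ) :
    Prop where
  pos : 0 < N
  ae_norm_le : ∀ ℓ : ℕ, ℓ * timeStep N ≤ T →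
    ∀ᵐ x ∂(gridCurve V N μ₀ ℓ : Measure (Space n)), ‖x‖ ≤ A
  ae_norm_snd_add_le : ∀ ℓ : ℕ, ℓ * timeStep N ≤ T →
    ∀ᵐ p ∂(V (gridCurve V N μ₀ ℓ) : Measure (TSpace n)), ‖p.snd‖ + roundingError n N ≤ B

section Growth

lemma PVF.SupportSublinear.ae_norm_snd_add_le (hV : V.SupportSublinear C) (hC : 0 < C)
    {P : ProbabilityMeasure (Space n)} {e K : ℝ}
    (h : ∀ᵐ x ∂(P : Measure (Space n)), 1 + ‖x‖ + e / C ≤ K) :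
    ∀ᵐ p ∂(V P : Measure (TSpace n)), ‖p.snd‖ + e ≤ C * K := by
  obtain ⟨x, hx⟩ := h.exists
  have hK : 0 ≤ K - 1 - e / C := by linarith [norm_nonneg x]
  filter_upwards [hV.ae_norm_snd_le hC.le hK (h.mono fun x hx => by linarith)] with p hp
  calc ‖p.snd‖ + e ≤ C * (1 + (K - 1 - e / C)) + e := by gcongr
    _ = C * K := by field_simp; ring

lemma ae_norm_gridCurve_le (hV : V.SupportSublinear C) (hC : 0 < C) (hN : 0 < N)
    (hμ₀ : ∀ᵐ x ∂(μ₀ : Measure (Space n)), ‖x‖ ≤ R) (ℓ : ℕ) :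
    ∀ᵐ x ∂(gridCurve V N μ₀ ℓ : Measure (Space n)), 1 + ‖x‖ + roundingError n N / C ≤
      (1 + R + roundingError n N + roundingError n N / C) * (1 + C * timeStep N) ^ ℓ := by
  have hmeas : ∀ K : ℝ, MeasurableSet
      {x : Space n | 1 + ‖x‖ + roundingError n N / C ≤ K} := fun K =>
    measurableSet_le (by fun_prop) measurable_const
  induction ℓ with
  | zero =>
    refine (ae_gridCurve_zero_iff (hmeas _)).2 ?_
    filter_upwards [hμ₀] with x hx
    have hsub := norm_sub_roundDown_spaceStep_le hN x
    have htri := norm_sub_norm_le (roundDown (spaceStep N) x) x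
    rw [norm_sub_rev] at htri
    linarith
  | succ ℓ ih =>
    refine (PVF.ae_push_iff (hmeas _)).2 ?_
    filter_upwards [V.ae_fst ih, hV.ae_norm_snd_add_le hC ih]
      with p hx hv
    have hmove := norm_move_le hN (timeStep_nonneg N) p
    have hvel := mul_le_mul_of_nonneg_left hv (timeStep_nonneg N)
    rw [pow_succ, ← mul_assoc]
    unfold roundingError at *
    linarith

/-- With `e = roundingError n N`, the bound `e^{CT}(1 + R + e + e/C)` for one plus the norm of the
positions reached on `[0,T]`; it comes from a discrete Grönwall inequality. -/
noncomputable def growthBound (n N : ℕ) (C R T : ℝ) : ℝ :=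
  (1 + R + roundingError n N + roundingError n N / C) * Real.exp (C * T)

lemma growthBound_le_growthBound_one (n N : ℕ) (hC : 0 ≤ C) :
    growthBound n N C R T ≤ growthBound n 1 C R T := by
  have h : roundingError n N ≤ roundingError n 1 := by
    refine mul_le_mul_of_nonneg_left ((timeStep_le_one N).trans_eq ?_) (Real.sqrt_nonneg _)
    rw [timeStep, Nat.cast_one, div_one]
  unfold growthBound
  gcongr

lemma tendsto_roundingError (n : ℕ) : Tendsto (roundingError n) atTop (𝓝 0) := by
  simpa only [mul_zero] using! (tendsto_one_div_atTop_nhds_zero_nat (𝕜 := ℝ)).const_mul √n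

lemma tendsto_growthBound (n : ℕ) (C R T : ℝ) :
    Tendsto (growthBound n · C R T) atTop (𝓝 ((1 + R) * Real.exp (C * T))) := by
  have he := tendsto_roundingError n
  simpa only [add_zero, zero_div] using!
    (((tendsto_const_nhds (x := 1 + R)).add he).add (he.div_const C)).mul_const (Real.exp (C * T))

lemma isGridBound_growthBound (hV : V.SupportSublinear C) (hC : 0 < C) (hN : 0 < N)
    (hμ₀ : ∀ᵐ x ∂(μ₀ : Measure (Space n)), ‖x‖ ≤ R) :
    IsGridBound V N μ₀ T (growthBound n N C R T) (C * growthBound n N C R T) := by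
  have he := roundingError_nonneg n N
  have hR : 0 ≤ R := hμ₀.exists.elim fun x hx => (norm_nonneg x).trans hx
  have hgrowth : ∀ ℓ : ℕ, ℓ * timeStep N ≤ T → ∀ᵐ x ∂(gridCurve V N μ₀ ℓ : Measure (Space n)),
      1 + ‖x‖ + roundingError n N / C ≤ growthBound n N C R T := fun ℓ hℓ => by
    have hexp : (1 + C * timeStep N) ^ ℓ ≤ Real.exp (C * T) := by
      calc (1 + C * timeStep N) ^ ℓ ≤ Real.exp (C * timeStep N) ^ ℓ := by
            have := timeStep_nonneg N
            gcongr
            linarith [Real.add_one_le_exp (C * timeStep N)]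
        _ = Real.exp (C * (ℓ * timeStep N)) := by rw [← Real.exp_nat_mul, mul_left_comm]
        _ ≤ Real.exp (C * T) := by gcongr
    filter_upwards [ae_norm_gridCurve_le hV hC hN hμ₀ ℓ] with x hx
    exact hx.trans (mul_le_mul_of_nonneg_left hexp (by positivity))
  refine ⟨hN, fun ℓ hℓ => ?_, fun ℓ hℓ => hV.ae_norm_snd_add_le hC (hgrowth ℓ hℓ)⟩
  filter_upwards [hgrowth ℓ hℓ] with x hx
  linarith [div_nonneg he hC.le]

end Growth

namespace IsGridBound

lemma mono (h : IsGridBound V N μ₀ T A B) {A' B' : ℝ} (hA : A ≤ A') (hB : B ≤ B') :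
    IsGridBound V N μ₀ T A' B' :=
  ⟨h.pos, fun ℓ hℓ => (h.ae_norm_le ℓ hℓ).mono fun _ hx => hx.trans hA,
    fun ℓ hℓ => (h.ae_norm_snd_add_le ℓ hℓ).mono fun _ hp => hp.trans hB⟩

lemma ae_norm_snd_le (h : IsGridBound V N μ₀ T A B) {ℓ : ℕ} (hℓ : ℓ * timeStep N ≤ T) :
    ∀ᵐ p ∂(V (gridCurve V N μ₀ ℓ) : Measure (TSpace n)), ‖p.snd‖ ≤ B :=
  (h.ae_norm_snd_add_le ℓ hℓ).mono fun _ hp =>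
    (le_add_of_nonneg_right (roundingError_nonneg n N)).trans hp

lemma ae_norm_roundDown_le (h : IsGridBound V N μ₀ T A B) {ℓ : ℕ} (hℓ : ℓ * timeStep N ≤ T) :
    ∀ᵐ p ∂(V (gridCurve V N μ₀ ℓ) : Measure (TSpace n)), ‖roundDown (timeStep N) p.snd‖ ≤ B :=
  (h.ae_norm_snd_add_le ℓ hℓ).mono fun _ hp => (norm_roundDown_le (timeStep_pos h.pos) _).trans hp

lemma ae_norm_stepCurve_le (h : IsGridBound V N μ₀ T A B) {t : ℝ} (ht : t ∈ Icc 0 T) :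
    ∀ᵐ x ∂(stepCurve V N μ₀ t : Measure (Space n)), ‖x‖ ≤ A + B := by
  have hℓ := floor_mul_timeStep_le h.pos ht.1
  refine (PVF.ae_push_iff (measurableSet_le measurable_norm measurable_const)).2 ?_
  filter_upwards [V.ae_fst (h.ae_norm_le _ (hℓ.trans ht.2)), h.ae_norm_snd_add_le _ (hℓ.trans ht.2)]
    with p hx hv
  refine (norm_move_le h.pos (sub_nonneg.2 hℓ) p).trans (add_le_add hx ?_)
  refine (mul_le_of_le_one_left ?_ ?_).trans hv
  · exact add_nonneg (norm_nonneg _) (roundingError_nonneg n N)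
  · exact (sub_floor_mul_timeStep_le h.pos t).trans (timeStep_le_one N)

lemma lasMove_eq_push (h : IsGridBound V N μ₀ T A B) (hA : A ≤ N) (hB : B ≤ N) {ℓ : ℕ}
    (hℓ : ℓ * timeStep N ≤ T) (s : ℝ) :
    lasMove V N (gridCurve V N μ₀ ℓ) s = V.push N s (gridCurve V N μ₀ ℓ) :=
  lasMove_eq_map V h.pos ((h.ae_norm_le ℓ hℓ).mono fun _ hx => hx.trans hA)
    (ae_mem_range_latticePoint_gridCurve V μ₀ h.pos ℓ)
    ((h.ae_norm_snd_le hℓ).mono fun _ hp => hp.trans hB) s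

lemma lasGrid_eq (h : IsGridBound V N μ₀ T A B) (hA : A ≤ N) (hB : B ≤ N)
    (hμ₀ : ∀ᵐ x ∂(μ₀ : Measure (Space n)), ‖x‖ ≤ N) {ℓ : ℕ} (hℓ : ℓ * timeStep N ≤ T) :
    lasGrid V N μ₀ ℓ = gridCurve V N μ₀ ℓ := by
  induction ℓ with
  | zero => exact discSpace_eq_map h.pos hμ₀
  | succ ℓ ih =>
    have hprev : ℓ * timeStep N ≤ T := by
      push_cast at hℓ
      linarith [timeStep_nonneg N]
    rw [lasGrid, ih hprev, h.lasMove_eq_push hA hB hprev, gridCurve]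

lemma las_eq_stepCurve (h : IsGridBound V N μ₀ T A B) (hA : A ≤ N) (hB : B ≤ N)
    (hμ₀ : ∀ᵐ x ∂(μ₀ : Measure (Space n)), ‖x‖ ≤ N) {t : ℝ} (ht : t ∈ Icc 0 T) :
    las V N μ₀ t = stepCurve V N μ₀ t := by
  have hℓ := (floor_mul_timeStep_le h.pos ht.1).trans ht.2
  rw [las, h.lasGrid_eq hA hB hμ₀ hℓ, h.lasMove_eq_push hA hB hℓ, stepCurve]

lemma lipschitzOnWith_stepCurve (h : IsGridBound V N μ₀ T A B) :
    LipschitzOnWith B.toNNReal (fun t => WassersteinSpace.of (stepCurve V N μ₀ t)) (Icc 0 T) := by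
  refine lipschitzOnWith_of_grid ordConnected_Icc (fun t ht => ht.1) (timeStep_pos h.pos)
    fun ℓ s hs t ht => ?_
  have hcell : ∀ r ∈ Icc 0 T ∩ Icc (ℓ * timeStep N) ((ℓ + 1) * timeStep N), stepCurve V N μ₀ r =
      V.push N (r - ℓ * timeStep N) (gridCurve V N μ₀ ℓ) := fun r ⟨_, hr⟩ => by
    rw [← stepCurve_add V μ₀ h.pos ℓ (by linarith [hr.1]) (by linarith [hr.2]), add_sub_cancel]
  rw [hcell s hs, hcell t ht]
  refine wasserstein_map_le _ (measurable_move N _) (measurable_move N _) ?_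
  filter_upwards [h.ae_norm_roundDown_le (hs.2.1.trans hs.1.2)] with p hp
  rw [move, move, edist_add_left, edist_eq_enorm_sub, ← sub_smul, sub_sub_sub_cancel_right,
    enorm_smul, mul_comm, ← edist_eq_enorm_sub]
  gcongr
  exact (ofReal_norm (roundDown (timeStep N) p.snd)).symm.trans_le (ENNReal.ofReal_le_ofReal hp)

end IsGridBound

end Approximants

section TestFunctions

/-- The quantitative regularity of test functions: the derivative of `f` is bounded by `M` and
Lipschitz with constant `K`. -/
structure HasLipschitzDeriv {E : Type*} [NormedAddCommGroup E] [NormedSpace ℝ E] (f : E → ℝ)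
    (M K : ℝ≥0) : Prop where
  differentiable : Differentiable ℝ f
  nnnorm_fderiv_le : ∀ x, ‖fderiv ℝ f x‖₊ ≤ M
  lipschitzWith_fderiv : LipschitzWith K (fderiv ℝ f)

lemma exists_hasLipschitzDeriv {E : Type*} [NormedAddCommGroup E] [NormedSpace ℝ E] {f : E → ℝ}
    (hf : ContDiff ℝ 2 f) (hfc : HasCompactSupport f) : ∃ M K, HasLipschitzDeriv f M K := by
  have hf' : ContDiff ℝ 1 (fderiv ℝ f) := hf.fderiv_right (by norm_num)
  obtain ⟨K, hK⟩ := hf'.lipschitzWith_of_hasCompactSupport (hfc.fderiv ℝ) one_ne_zero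
  obtain ⟨M, hM⟩ := (hfc.fderiv ℝ).exists_bound_of_continuous hf'.continuous
  exact ⟨M.toNNReal, K, hf.differentiable two_ne_zero, fun x => NNReal.le_toNNReal_of_coe_le (hM x),
    hK⟩

lemma gradPairing_eq_fderiv {n : ℕ} (f : Space n → ℝ) (p : TSpace n) :
    gradPairing f p = fderiv ℝ f p.fst p.snd :=
  inner_gradient_left

namespace HasLipschitzDeriv

lemma norm_sub_sub_sub_le {E : Type*} [NormedAddCommGroup E] [NormedSpace ℝ E] {f : E → ℝ}
    {M K : ℝ≥0} (hf : HasLipschitzDeriv f M K) (x v w : E) {τ s t : ℝ} (hs : s ∈ Icc 0 τ)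
    (ht : t ∈ Icc 0 τ) :
    ‖(f (x + t • w) - t * fderiv ℝ f x v) - (f (x + s • w) - s * fderiv ℝ f x v)‖ ≤
      (K * τ * ‖w‖ ^ 2 + M * ‖v - w‖) * ‖t - s‖ := by
  have hderiv : ∀ r : ℝ, HasDerivAt (fun r => f (x + r • w) - r * fderiv ℝ f x v)
      (fderiv ℝ f (x + r • w) w - fderiv ℝ f x v) r := fun r => by
    have hline : HasDerivAt (fun r : ℝ => x + r • w) w r := by
      simpa using ((hasDerivAt_id r).smul_const w).const_add x
    simpa using! ((hf.differentiable _).hasFDerivAt.comp_hasDerivAt r hline).sub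
      ((hasDerivAt_id r).mul_const (fderiv ℝ f x v))
  refine (convex_Icc 0 τ).norm_image_sub_le_of_norm_hasDerivWithin_le
    (fun r _ => (hderiv r).hasDerivWithinAt) (fun r hr => ?_) hs ht
  calc ‖fderiv ℝ f (x + r • w) w - fderiv ℝ f x v‖
      = ‖(fderiv ℝ f (x + r • w) - fderiv ℝ f x) w - fderiv ℝ f x (v - w)‖ := by
        rw [sub_apply, map_sub, sub_sub_sub_cancel_right]
    _ ≤ ‖fderiv ℝ f (x + r • w) - fderiv ℝ f x‖ * ‖w‖ + ‖fderiv ℝ f x‖ * ‖v - w‖ :=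
        (norm_sub_le _ _).trans (add_le_add (ContinuousLinearMap.le_opNorm _ _)
          (ContinuousLinearMap.le_opNorm _ _))
    _ ≤ K * (τ * ‖w‖) * ‖w‖ + M * ‖v - w‖ := by
        gcongr
        · refine (hf.lipschitzWith_fderiv.norm_sub_le _ _).trans ?_
          rw [add_sub_cancel_left, norm_smul, Real.norm_of_nonneg hr.1]
          gcongr
          exact hr.2
        · exact hf.nnnorm_fderiv_le x
    _ = K * τ * ‖w‖ ^ 2 + M * ‖v - w‖ := by ring

variable {n : ℕ} {f : Space n → ℝ} {M K : ℝ≥0}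

lemma lipschitzOnWith_gradPairing (hf : HasLipschitzDeriv f M K) (B : ℝ≥0) :
    LipschitzOnWith (K * B + M) (gradPairing f) {p | ‖p.snd‖ ≤ B} := by
  refine LipschitzOnWith.of_dist_le_mul fun p hp q _ => ?_
  simp only [gradPairing_eq_fderiv, dist_eq_norm]
  have hfst : ‖p.fst - q.fst‖ ≤ ‖p - q‖ := WithLp.norm_fst_le _ (p - q)
  have hsnd : ‖p.snd - q.snd‖ ≤ ‖p - q‖ := WithLp.norm_snd_le _ (p - q)
  calc ‖fderiv ℝ f p.fst p.snd - fderiv ℝ f q.fst q.snd‖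
      = ‖(fderiv ℝ f p.fst - fderiv ℝ f q.fst) p.snd + fderiv ℝ f q.fst (p.snd - q.snd)‖ := by
        rw [sub_apply, map_sub, sub_add_sub_cancel]
    _ ≤ ‖fderiv ℝ f p.fst - fderiv ℝ f q.fst‖ * ‖p.snd‖ +
          ‖fderiv ℝ f q.fst‖ * ‖p.snd - q.snd‖ :=
        (norm_add_le _ _).trans (add_le_add (ContinuousLinearMap.le_opNorm _ _)
          (ContinuousLinearMap.le_opNorm _ _))
    _ ≤ K * ‖p - q‖ * B + M * ‖p - q‖ := by
        gcongr
        · exact (hf.lipschitzWith_fderiv.norm_sub_le _ _).trans (by gcongr)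
        · exact hp
        · exact hf.nnnorm_fderiv_le _
    _ = ↑(K * B + M) * ‖p - q‖ := by push_cast; ring

lemma integrable_gradPairing (hf : HasLipschitzDeriv f M K) {P : Measure (TSpace n)}
    [IsFiniteMeasure P] {B : ℝ} (h : ∀ᵐ p ∂P, ‖p.snd‖ ≤ B) : Integrable (gradPairing f) P := by
  have hcont : Continuous (gradPairing f) := by
    simp only [funext (gradPairing_eq_fderiv f)]
    exact (hf.lipschitzWith_fderiv.continuous.comp (by fun_prop)).clm_apply (by fun_prop)
  refine Integrable.of_bound hcont.aestronglyMeasurable (M * B) ?_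
  filter_upwards [h] with p hp
  rw [gradPairing_eq_fderiv]
  exact (ContinuousLinearMap.le_opNorm _ _).trans
    (mul_le_mul (hf.nnnorm_fderiv_le _) hp (norm_nonneg _) M.coe_nonneg)

end HasLipschitzDeriv

lemma lipschitzOnWith_integral {X : Type*} [EMetricSpace X] [SecondCountableTopology X]
    [MeasurableSpace X] [BorelSpace X] [StandardBorelSpace X] {g : X → ℝ} {L : ℝ≥0} {s : Set X}
    (hg : LipschitzOnWith L g s) :
    LipschitzOnWith L
      (fun P : WassersteinSpace X => ∫ x, g x ∂(P.toProbabilityMeasure : Measure X))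
      {P | Integrable g (P.toProbabilityMeasure : Measure X) ∧
        ∀ᵐ x ∂(P.toProbabilityMeasure : Measure X), x ∈ s} := fun P hP Q hQ => by
  rw [edist_eq_enorm_sub]
  exact enorm_integral_sub_le_wasserstein hg hP.1 hQ.1 hP.2 hQ.2

variable {n : ℕ} {V : PVF n} {f : Space n → ℝ} {M K : ℝ≥0} {C r : ℝ}

/-- The rate `∫ ∇f(x) · v dV[μ](x,v)` at which `∫ f dμ` changes when `μ` moves along `V`. -/
noncomputable def PVF.meanDeriv (V : PVF n) (f : Space n → ℝ)
    (μ : ProbabilityMeasure (Space n)) : ℝ :=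
  ∫ p, gradPairing f p ∂(V μ : Measure (TSpace n))

lemma ae_norm_le_of_mem_concentratedOn {P : WassersteinSpace (Space n)}
    (hP : P ∈ WassersteinSpace.concentratedOn (Metric.closedBall 0 r)) :
    ∀ᵐ x ∂(P.toProbabilityMeasure : Measure (Space n)), ‖x‖ ≤ r :=
  Eventually.mono hP fun _ => mem_closedBall_zero_iff.1

lemma hasCompactSupp_of_mem_concentratedOn {P : WassersteinSpace (Space n)}
    (hP : P ∈ WassersteinSpace.concentratedOn (Metric.closedBall 0 r)) :
    HasCompactSupp P.toProbabilityMeasure :=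
  hasCompactSupp_of_ae_norm_le (ae_norm_le_of_mem_concentratedOn hP)

lemma PVF.WassersteinContinuous.continuousOn_concentratedOn (hc : V.WassersteinContinuous) :
    ContinuousOn (fun P : WassersteinSpace (Space n) =>
      WassersteinSpace.of (V P.toProbabilityMeasure))
      (WassersteinSpace.concentratedOn (Metric.closedBall 0 r)) :=
  EMetric.continuousOn_iff.2 fun P hP ε hε => by
    obtain ⟨δ, hδ, h⟩ := hc _ (hasCompactSupp_of_mem_concentratedOn hP) ε hε
    exact ⟨δ, hδ, fun _ hQ => h _ (hasCompactSupp_of_mem_concentratedOn hQ)⟩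

lemma PVF.WassersteinContinuous.continuousOn_meanDeriv (hc : V.WassersteinContinuous)
    (hV : V.SupportSublinear C) (hC : 0 ≤ C) (hr : 0 ≤ r) (hf : HasLipschitzDeriv f M K) :
    ContinuousOn (fun P : WassersteinSpace (Space n) => V.meanDeriv f P.toProbabilityMeasure)
      (WassersteinSpace.concentratedOn (Metric.closedBall 0 r)) := by
  refine (lipschitzOnWith_integral
    (hf.lipschitzOnWith_gradPairing (C * (1 + r)).toNNReal)).continuousOn.comp
      hc.continuousOn_concentratedOn fun P hP => ?_
  have hvel := hV.ae_norm_snd_le hC hr (ae_norm_le_of_mem_concentratedOn hP)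
  exact ⟨hf.integrable_gradPairing hvel, hvel.mono fun p hp => hp.trans (Real.le_coe_toNNReal _)⟩

variable {N : ℕ} {μ₀ : ProbabilityMeasure (Space n)} {T A B : ℝ}

namespace IsGridBound

lemma norm_integral_push_sub_le (h : IsGridBound V N μ₀ T A B) (hf : HasLipschitzDeriv f M K)
    (hfc : HasCompactSupport f) {ℓ : ℕ} (hℓ : ℓ * timeStep N ≤ T) {s t : ℝ}
    (hs : s ∈ Icc 0 (timeStep N)) (ht : t ∈ Icc 0 (timeStep N)) :
    ‖(∫ x, f x ∂(V.push N t (gridCurve V N μ₀ ℓ) : Measure (Space n))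
        - t * V.meanDeriv f (gridCurve V N μ₀ ℓ)) -
      (∫ x, f x ∂(V.push N s (gridCurve V N μ₀ ℓ) : Measure (Space n))
        - s * V.meanDeriv f (gridCurve V N μ₀ ℓ))‖ ≤
      (K * timeStep N * B ^ 2 + M * roundingError n N) * ‖t - s‖ := by
  set P : Measure (TSpace n) := (V (gridCurve V N μ₀ ℓ) : Measure (TSpace n))
  have hmove : ∀ r, Integrable (fun p => f (move N r p)) P := fun r =>
    (hf.differentiable.continuous.integrable_of_hasCompactSupport hfc).comp_measurable
      (measurable_move N r)
  have hgrad := hf.integrable_gradPairing (h.ae_norm_snd_le hℓ)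
  have hint : ∀ r, ∫ x, f x ∂(V.push N r (gridCurve V N μ₀ ℓ) : Measure (Space n))
      - r * V.meanDeriv f (gridCurve V N μ₀ ℓ) =
      ∫ p, (f (move N r p) - r * gradPairing f p) ∂P := fun r => by
    rw [integral_sub (hmove r) (hgrad.const_mul r), integral_const_mul, PVF.coe_push,
      integral_map (measurable_move N r).aemeasurable
        hf.differentiable.continuous.aestronglyMeasurable, PVF.meanDeriv]
  have hsub : ∀ r, Integrable (fun p => f (move N r p) - r * gradPairing f p) P := fun r =>
    (hmove r).sub (hgrad.const_mul r)
  rw [hint, hint, ← integral_sub (hsub t) (hsub s)]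
  refine (norm_integral_le_of_norm_le_const ?_).trans_eq (by rw [probReal_univ, mul_one])
  filter_upwards [h.ae_norm_roundDown_le hℓ] with p hp
  simp only [gradPairing_eq_fderiv]
  refine (hf.norm_sub_sub_sub_le p.fst p.snd (roundDown (timeStep N) p.snd) hs ht).trans ?_
  have hτ := timeStep_nonneg N
  gcongr
  exact norm_sub_roundDown_le (timeStep_pos h.pos) p.snd

lemma lipschitzOnWith_integral_stepCurve_sub (h : IsGridBound V N μ₀ T A B)
    (hf : HasLipschitzDeriv f M K) (hfc : HasCompactSupport f) {ℓ : ℕ} (hℓ : ℓ * timeStep N ≤ T)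
    {a : ℝ} {L : ℝ≥0} (hL : K * timeStep N * B ^ 2 + M * roundingError n N +
      dist (V.meanDeriv f (gridCurve V N μ₀ ℓ)) a ≤ L) :
    LipschitzOnWith L (fun t => ∫ x, f x ∂(stepCurve V N μ₀ t : Measure (Space n)) - t * a)
      (Icc (ℓ * timeStep N) ((ℓ + 1) * timeStep N)) := by
  set b := V.meanDeriv f (gridCurve V N μ₀ ℓ) with hb
  refine LipschitzOnWith.of_dist_le_mul fun t ht s hs => ?_
  have hoffset : ∀ r ∈ Icc (ℓ * timeStep N) ((ℓ + 1) * timeStep N),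
      r - ℓ * timeStep N ∈ Icc 0 (timeStep N) := fun r hr =>
    ⟨by linarith [hr.1], by linarith [hr.2]⟩
  have hcell : ∀ r ∈ Icc (ℓ * timeStep N) ((ℓ + 1) * timeStep N), stepCurve V N μ₀ r =
      V.push N (r - ℓ * timeStep N) (gridCurve V N μ₀ ℓ) := fun r hr => by
    rw [← stepCurve_add V μ₀ h.pos ℓ (hoffset r hr).1 (hoffset r hr).2, add_sub_cancel]
  have hcenter := h.norm_integral_push_sub_le hf hfc hℓ (hoffset s hs) (hoffset t ht)
  rw [← hcell s hs, ← hcell t ht, ← hb, sub_sub_sub_cancel_right] at hcenter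
  have hdiff : ‖(t - s) * (b - a)‖ ≤ dist b a * ‖t - s‖ := by
    rw [norm_mul, mul_comm, dist_eq_norm]
  rw [dist_eq_norm, dist_eq_norm]
  refine le_trans ?_ (mul_le_mul_of_nonneg_right hL (norm_nonneg (t - s)))
  rw [add_mul]
  refine le_trans (le_of_eq ?_) ((norm_add_le _ _).trans (add_le_add hcenter hdiff))
  congr 1
  ring

end IsGridBound

end TestFunctions

section LimitCurves

lemma lipschitzOnWith_of_tendsto {ι α Y : Type*} [PseudoMetricSpace α] [PseudoEMetricSpace Y]
    {l : Filter ι} [l.NeBot] {u : ι → α → Y} {v : α → Y} {S : Set α} {L : ι → ℝ≥0} {L₀ : ℝ≥0}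
    (hu : ∀ x ∈ S, Tendsto (u · x) l (𝓝 (v x))) (hL : Tendsto L l (𝓝 L₀))
    (h : ∀ᶠ i in l, LipschitzOnWith (L i) (u i) S) : LipschitzOnWith L₀ v S := fun x hx y hy =>
  le_of_tendsto_of_tendsto ((hu x hx).edist (hu y hy))
    (ENNReal.Tendsto.mul_const (ENNReal.tendsto_coe.2 hL) (Or.inr (edist_ne_top x y)))
    (h.mono fun _ hi => hi hx hy)

lemma hasDerivAt_of_lipschitzOnWith {F : ℝ → ℝ} {a s : ℝ}
    (h : ∀ η : ℝ≥0, 0 < η → ∃ U ∈ 𝓝 s, LipschitzOnWith η (fun t => F t - t * a) U) :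
    HasDerivAt F a s := by
  refine hasDerivAt_iff_isLittleO.2 (Asymptotics.isLittleO_iff.2 fun η hη => ?_)
  obtain ⟨U, hU, hlip⟩ := h ⟨η, hη.le⟩ hη
  filter_upwards [hU] with t ht
  have hts := hlip.norm_sub_le ht (mem_of_mem_nhds hU)
  rwa [sub_sub_sub_comm, ← sub_mul] at hts

/-- The curve `μ` is on `[0,T]` the pointwise Wasserstein limit of untruncated lattice approximate
solutions which have common bounds `A` and `B` and whose step sizes `1/N k` tend to `0`. -/
structure IsLimitCurve {n : ℕ} (V : PVF n) (μ₀ : ProbabilityMeasure (Space n)) (T A B : ℝ)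
    (N : ℕ → ℕ) (μ : ℝ → ProbabilityMeasure (Space n)) : Prop where
  tendsto_atTop : Tendsto N atTop atTop
  isGridBound : ∀ k, IsGridBound V (N k) μ₀ T A B
  tendsto_stepCurve : ∀ t ∈ Icc 0 T,
    Tendsto (fun k => WassersteinSpace.of (stepCurve V (N k) μ₀ t)) atTop
      (𝓝 (WassersteinSpace.of (μ t)))

variable {n : ℕ} {V : PVF n} {μ₀ : ProbabilityMeasure (Space n)} {T A B C : ℝ} {N : ℕ → ℕ}
  {μ : ℝ → ProbabilityMeasure (Space n)} {f : Space n → ℝ} {M K : ℝ≥0}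

lemma IsGridBound.stepCurve_mem_concentratedOn {N : ℕ} (h : IsGridBound V N μ₀ T A B) {t : ℝ}
    (ht : t ∈ Icc 0 T) : WassersteinSpace.of (stepCurve V N μ₀ t) ∈
      WassersteinSpace.concentratedOn (Metric.closedBall 0 (A + B)) :=
  (h.ae_norm_stepCurve_le ht).mono fun _ => mem_closedBall_zero_iff.2

lemma IsGridBound.edist_gridCurve_stepCurve_le {N : ℕ} (h : IsGridBound V N μ₀ T A B) {ℓ : ℕ}
    {s t : ℝ} (hs : s ∈ Icc 0 T) (htT : t ≤ T)
    (ht : t ∈ Icc (ℓ * timeStep N) ((ℓ + 1) * timeStep N)) :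
    edist (WassersteinSpace.of (gridCurve V N μ₀ ℓ)) (WassersteinSpace.of (stepCurve V N μ₀ s)) ≤
      B.toNNReal * ENNReal.ofReal (timeStep N + |t - s|) := by
  have hτ := timeStep_nonneg N
  have hℓ : ℓ * timeStep N ∈ Icc 0 T := ⟨by positivity, ht.1.trans htT⟩
  rw [← stepCurve_mul_timeStep V μ₀ h.pos]
  refine (h.lipschitzOnWith_stepCurve hℓ hs).trans ?_
  rw [edist_dist]
  gcongr
  refine (dist_triangle _ t s).trans (add_le_add_left (abs_le.2 ⟨?_, ?_⟩) _) <;>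
    linarith [ht.1, ht.2]

lemma HasLipschitzDeriv.lipschitzWith_integral (hf : HasLipschitzDeriv f M K)
    (hfc : HasCompactSupport f) : LipschitzWith M
      (fun P : WassersteinSpace (Space n) =>
        ∫ x, f x ∂(P.toProbabilityMeasure : Measure (Space n))) := by
  have hflip := lipschitzWith_of_nnnorm_fderiv_le hf.differentiable hf.nnnorm_fderiv_le
  refine lipschitzOnWith_univ.1 ((lipschitzOnWith_integral
    (lipschitzOnWith_univ.2 hflip)).mono fun P _ => ?_)
  exact ⟨hflip.continuous.integrable_of_hasCompactSupport hfc, ae_of_all _ mem_univ⟩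

lemma tendsto_timeStep : Tendsto timeStep atTop (𝓝 0) :=
  tendsto_one_div_atTop_nhds_zero_nat

namespace IsLimitCurve

lemma apply_zero (h : IsLimitCurve V μ₀ T A B N μ) (hT : 0 ≤ T) : μ 0 = μ₀ := by
  have hinit : Tendsto (fun k => WassersteinSpace.of (stepCurve V (N k) μ₀ 0)) atTop
      (𝓝 (WassersteinSpace.of μ₀)) := by
    rw [tendsto_iff_edist_tendsto_0]
    have herr : Tendsto (fun k => ENNReal.ofReal (roundingError n (N k))) atTop (𝓝 0) := by
      simpa using! ENNReal.tendsto_ofReal ((tendsto_roundingError n).comp h.tendsto_atTop)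
    exact tendsto_of_tendsto_of_tendsto_of_le_of_le tendsto_const_nhds herr (fun _ => zero_le)
      fun k => wasserstein_stepCurve_zero_le V μ₀ (h.isGridBound k).pos
  exact congrArg WassersteinSpace.toProbabilityMeasure
    (tendsto_nhds_unique (h.tendsto_stepCurve 0 (left_mem_Icc.2 hT)) hinit)

lemma mem_concentratedOn (h : IsLimitCurve V μ₀ T A B N μ) {t : ℝ} (ht : t ∈ Icc 0 T) :
    WassersteinSpace.of (μ t) ∈ WassersteinSpace.concentratedOn (Metric.closedBall 0 (A + B)) :=
  (WassersteinSpace.isCompact_concentratedOn (isCompact_closedBall _ _)).isClosed.mem_of_tendsto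
    (h.tendsto_stepCurve t ht)
    (.of_forall fun k => (h.isGridBound k).stepCurve_mem_concentratedOn ht)

lemma lipschitzOnWith (h : IsLimitCurve V μ₀ T A B N μ) :
    LipschitzOnWith B.toNNReal (fun t => WassersteinSpace.of (μ t)) (Icc 0 T) :=
  lipschitzOnWith_of_tendsto h.tendsto_stepCurve tendsto_const_nhds
    (.of_forall fun k => (h.isGridBound k).lipschitzOnWith_stepCurve)

lemma tendsto_integral (h : IsLimitCurve V μ₀ T A B N μ) (hf : HasLipschitzDeriv f M K)
    (hfc : HasCompactSupport f) {t : ℝ} (ht : t ∈ Icc 0 T) :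
    Tendsto (fun k => ∫ x, f x ∂(stepCurve V (N k) μ₀ t : Measure (Space n))) atTop
      (𝓝 (∫ x, f x ∂(μ t : Measure (Space n)))) :=
  ((hf.lipschitzWith_integral hfc).continuous.tendsto _).comp (h.tendsto_stepCurve t ht)

lemma radius_nonneg (h : IsLimitCurve V μ₀ T A B N μ) (hT : 0 ≤ T) : 0 ≤ A + B := by
  obtain ⟨x, hx⟩ := (ae_norm_le_of_mem_concentratedOn
    (h.mem_concentratedOn (left_mem_Icc.2 hT))).exists
  exact (norm_nonneg x).trans hx

lemma exists_edist_gridCurve_lt (h : IsLimitCurve V μ₀ T A B N μ) {s : ℝ} (hs : s ∈ Ioo 0 T)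
    {δ : ℝ≥0∞} (hδ : 0 < δ) :
    ∃ r > 0, Icc (s - r) (s + r) ⊆ Icc 0 T ∧ ∀ᶠ k in atTop, ∀ ℓ : ℕ,
      (Icc (s - r) (s + r) ∩ Icc (ℓ * timeStep (N k)) ((ℓ + 1) * timeStep (N k))).Nonempty →
        edist (WassersteinSpace.of (gridCurve V (N k) μ₀ ℓ)) (WassersteinSpace.of (μ s)) < δ := by
  have hsT : s ∈ Icc 0 T := Ioo_subset_Icc_self hs
  obtain ⟨r, hr, hrδ, hrT⟩ : ∃ r > 0, B.toNNReal * ENNReal.ofReal r < δ ∧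
      Icc (s - r) (s + r) ⊆ Icc 0 T := by
    have hlim : Tendsto (fun r => B.toNNReal * ENNReal.ofReal r) (𝓝 0) (𝓝 0) := by
      simpa using ENNReal.Tendsto.const_mul (ENNReal.tendsto_ofReal (tendsto_id (x := 𝓝 0)))
        (Or.inr (ENNReal.coe_ne_top (r := B.toNNReal)))
    obtain ⟨r, ⟨hr, hrδ, hrs⟩⟩ := (eventually_mem_nhdsWithin.and
      (((hlim.eventually (gt_mem_nhds hδ)).filter_mono nhdsWithin_le_nhds).and
      (Ioo_mem_nhdsGT (lt_min hs.1 (sub_pos.2 hs.2))))).exists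
    obtain ⟨h0, h1⟩ := le_min_iff.1 hrs.2.le
    exact ⟨r, hr, hrδ, Icc_subset_Icc (by linarith) (by linarith)⟩
  refine ⟨r, hr, hrT, ?_⟩
  have hlim : Tendsto (fun k => B.toNNReal * ENNReal.ofReal (timeStep (N k) + r) +
      edist (WassersteinSpace.of (stepCurve V (N k) μ₀ s)) (WassersteinSpace.of (μ s))) atTop
      (𝓝 (B.toNNReal * ENNReal.ofReal r)) := by
    simpa using! (ENNReal.Tendsto.const_mul (ENNReal.tendsto_ofReal
      ((tendsto_timeStep.comp h.tendsto_atTop).add_const r)) (Or.inr ENNReal.coe_ne_top)).add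
      (tendsto_iff_edist_tendsto_0.1 (h.tendsto_stepCurve s hsT))
  filter_upwards [hlim.eventually (gt_mem_nhds hrδ)] with k hk ℓ ⟨t, htr, htℓ⟩
  have hts : |t - s| ≤ r := abs_le.2 ⟨by linarith [htr.1], by linarith [htr.2]⟩
  refine lt_of_le_of_lt ((edist_triangle _ (WassersteinSpace.of (stepCurve V (N k) μ₀ s)) _).trans
    (add_le_add_left ?_ _)) hk
  exact ((h.isGridBound k).edist_gridCurve_stepCurve_le hsT (hrT htr).2 htℓ).trans (by gcongr)

lemma exists_dist_meanDeriv_gridCurve_lt (h : IsLimitCurve V μ₀ T A B N μ)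
    (hc : V.WassersteinContinuous) (hV : V.SupportSublinear C) (hC : 0 ≤ C)
    (hf : HasLipschitzDeriv f M K) {s : ℝ} (hs : s ∈ Ioo 0 T) {ε : ℝ} (hε : 0 < ε) :
    ∃ r > 0, Icc (s - r) (s + r) ⊆ Icc 0 T ∧ ∀ᶠ k in atTop, ∀ ℓ : ℕ,
      (Icc (s - r) (s + r) ∩ Icc (ℓ * timeStep (N k)) ((ℓ + 1) * timeStep (N k))).Nonempty →
        dist (V.meanDeriv f (gridCurve V (N k) μ₀ ℓ)) (V.meanDeriv f (μ s)) < ε := by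
  have hcont := hc.continuousOn_meanDeriv hV hC (h.radius_nonneg (hs.1.trans hs.2).le) hf _
    (h.mem_concentratedOn (Ioo_subset_Icc_self hs))
  obtain ⟨δ, hδ, hball⟩ := EMetric.mem_nhdsWithin_iff.1 (hcont (Metric.ball_mem_nhds _ hε))
  obtain ⟨r, hr, hrT, hnear⟩ := h.exists_edist_gridCurve_lt hs hδ
  refine ⟨r, hr, hrT, hnear.mono fun k hk ℓ hℓ => hball ⟨hk ℓ hℓ, ?_⟩⟩
  obtain ⟨t, htr, htℓ⟩ := hℓ
  have hτ := timeStep_nonneg (N k)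
  rw [← stepCurve_mul_timeStep V μ₀ (h.isGridBound k).pos]
  exact (h.isGridBound k).stepCurve_mem_concentratedOn
    ⟨by positivity, htℓ.1.trans (hrT htr).2⟩

lemma exists_lipschitzOnWith_integral_sub (h : IsLimitCurve V μ₀ T A B N μ)
    (hc : V.WassersteinContinuous) (hV : V.SupportSublinear C) (hC : 0 ≤ C)
    (hf : HasLipschitzDeriv f M K) (hfc : HasCompactSupport f) {s : ℝ} (hs : s ∈ Ioo 0 T)
    {η : ℝ≥0} (hη : 0 < η) :
    ∃ U ∈ 𝓝 s, LipschitzOnWith η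
      (fun t => ∫ x, f x ∂(μ t : Measure (Space n)) - t * V.meanDeriv f (μ s)) U := by
  have hη2 : (0 : ℝ) < η / 2 := half_pos (NNReal.coe_pos.2 hη)
  obtain ⟨r, hr, hrT, hnear⟩ := h.exists_dist_meanDeriv_gridCurve_lt hc hV hC hf hs hη2
  have herr : Tendsto (fun k => K * timeStep (N k) * B ^ 2 + M * roundingError n (N k)) atTop
      (𝓝 0) := by
    simpa using! (((tendsto_timeStep.comp h.tendsto_atTop).const_mul (K : ℝ)).mul_const
      (B ^ 2)).add (((tendsto_roundingError n).comp h.tendsto_atTop).const_mul (M : ℝ))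
  refine ⟨Icc (s - r) (s + r), Icc_mem_nhds (by linarith) (by linarith),
    lipschitzOnWith_of_tendsto (fun t ht => (h.tendsto_integral hf hfc (hrT ht)).sub_const _)
      (tendsto_const_nhds (f := atTop)) ?_⟩
  filter_upwards [hnear, herr.eventually (gt_mem_nhds hη2)] with k hk hek
  have hQ := h.isGridBound k
  refine lipschitzOnWith_of_grid ordConnected_Icc (fun t ht => (hrT ht).1) (timeStep_pos hQ.pos)
    fun ℓ => ?_
  rcases (Icc (s - r) (s + r) ∩ Icc (ℓ * timeStep (N k)) ((ℓ + 1) * timeStep (N k))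
    ).eq_empty_or_nonempty with hempty | hne
  · rw [hempty]
    exact lipschitzOnWith_empty _ _
  · have hℓ : ℓ * timeStep (N k) ≤ T := hne.elim fun t ht => ht.2.1.trans (hrT ht.1).2
    exact (hQ.lipschitzOnWith_integral_stepCurve_sub hf hfc hℓ
      (by linarith [hk ℓ hne])).mono inter_subset_right

theorem isSolution (h : IsLimitCurve V μ₀ T A B N μ) (hc : V.WassersteinContinuous)
    (hV : V.SupportSublinear C) (hC : 0 ≤ C) (hT : 0 ≤ T) : IsSolution V T μ₀ μ := by
  refine ⟨h.apply_zero hT, fun f hf hfc => ?_⟩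
  obtain ⟨M, K, hfd⟩ := exists_hasLipschitzDeriv (hf.of_le (by norm_cast)) hfc
  have hr := h.radius_nonneg hT
  refine ⟨ae_restrict_of_forall_mem measurableSet_Icc fun s hs => ?_, ?_, ?_, ?_⟩
  · exact hfd.integrable_gradPairing (hV.ae_norm_snd_le hC hr
      (ae_norm_le_of_mem_concentratedOn (h.mem_concentratedOn hs)))
  · exact ((hc.continuousOn_meanDeriv hV hC hr hfd).comp h.lipschitzOnWith.continuousOn
      fun s hs => h.mem_concentratedOn hs).integrableOn_Icc
  · refine LipschitzOnWith.absolutelyContinuousOnInterval (K := M * B.toNNReal) ?_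
    rw [uIcc_of_le hT]
    exact (hfd.lipschitzWith_integral hfc).comp_lipschitzOnWith h.lipschitzOnWith
  · rw [← Measure.restrict_congr_set Ioo_ae_eq_Icc]
    exact ae_restrict_of_forall_mem measurableSet_Ioo fun s hs =>
      hasDerivAt_of_lipschitzOnWith fun η hη =>
        h.exists_lipschitzOnWith_integral_sub hc hV hC hfd hfc hs hη

end IsLimitCurve

end LimitCurves

section Convergence

variable {n : ℕ} {V : PVF n} {μ₀ : ProbabilityMeasure (Space n)} {C R T : ℝ}

lemma eventually_las_eq_stepCurve (hV : V.SupportSublinear C) (hC : 0 < C)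
    (hμ₀ : ∀ᵐ x ∂(μ₀ : Measure (Space n)), ‖x‖ ≤ R) :
    ∀ᶠ N in atTop, ∀ t ∈ Icc 0 T, las V N μ₀ t = stepCurve V N μ₀ t := by
  have hge := (tendsto_natCast_atTop_atTop (R := ℝ)).eventually_ge_atTop
  filter_upwards [eventually_gt_atTop 0, hge R, hge (growthBound n 1 C R T),
    hge (C * growthBound n 1 C R T)] with N hN hRN hA hB t ht
  have hle : growthBound n N C R T ≤ growthBound n 1 C R T :=
    growthBound_le_growthBound_one n N hC.le
  exact (isGridBound_growthBound hV hC hN hμ₀).las_eq_stepCurve (hle.trans hA)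
    ((mul_le_mul_of_nonneg_left hle hC.le).trans hB) (hμ₀.mono fun _ hx => hx.trans hRN) ht

lemma exists_isLimitCurve (hV : V.SupportSublinear C) (hC : 0 < C) (hT : 0 ≤ T)
    (hμ₀ : ∀ᵐ x ∂(μ₀ : Measure (Space n)), ‖x‖ ≤ R) :
    ∃ (μ : ℝ → ProbabilityMeasure (Space n)) (A B : ℝ) (φ : ℕ → ℕ), StrictMono φ ∧
      IsLimitCurve V μ₀ T A B φ μ ∧
      Tendsto (fun k => ⨆ t ∈ Icc 0 T,
        wasserstein (stepCurve V (φ k) μ₀ t : Measure (Space n)) (μ t)) atTop (𝓝 0) := by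
  set A := growthBound n 1 C R T
  have hQ : ∀ k, IsGridBound V (k + 1) μ₀ T A (C * A) := fun k =>
    have hle : growthBound n (k + 1) C R T ≤ A := growthBound_le_growthBound_one n _ hC.le
    (isGridBound_growthBound hV hC k.succ_pos hμ₀).mono hle (mul_le_mul_of_nonneg_left hle hC.le)
  obtain ⟨ν, φ, hφ, hlim⟩ := exists_subseq_tendsto_iSup_edist
    (WassersteinSpace.isCompact_concentratedOn (isCompact_closedBall (0 : Space n) (A + C * A)))
    (u := fun k (t : Icc 0 T) => WassersteinSpace.of (stepCurve V (k + 1) μ₀ t))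
    (fun k t => (hQ k).stepCurve_mem_concentratedOn t.2)
    fun k => lipschitzOnWith_iff_restrict.1 (hQ k).lipschitzOnWith_stepCurve
  set μ : ℝ → ProbabilityMeasure (Space n) := fun t => (ν (projIcc 0 T hT t)).toProbabilityMeasure
  have hsup : Tendsto (fun k => ⨆ t ∈ Icc 0 T,
      wasserstein (stepCurve V (φ k + 1) μ₀ t : Measure (Space n)) (μ t)) atTop (𝓝 0) := by
    refine hlim.congr fun k => iSup_subtype.trans (iSup_congr fun t => iSup_congr fun ht => ?_)
    simp only [μ, projIcc_of_mem hT ht]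
    rfl
  have hmono : StrictMono fun k => φ k + 1 := fun i j hij => Nat.succ_lt_succ (hφ hij)
  refine ⟨μ, A, C * A, fun k => φ k + 1, hmono, ⟨hmono.tendsto_atTop, fun k => hQ (φ k),
    fun t ht => tendsto_iff_edist_tendsto_0.2 ?_⟩, hsup⟩
  exact tendsto_of_tendsto_of_tendsto_of_le_of_le tendsto_const_nhds hsup (fun _ => zero_le)
    fun k => le_iSup₂ (f := fun t (_ : t ∈ Icc 0 T) =>
      wasserstein (stepCurve V (φ k + 1) μ₀ t : Measure (Space n)) (μ t)) t ht

lemma IsLimitCurve.wasserstein_le {A B : ℝ} {N : ℕ → ℕ} {μ : ℝ → ProbabilityMeasure (Space n)}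
    (h : IsLimitCurve V μ₀ T A B N μ) (hV : V.SupportSublinear C) (hC : 0 < C)
    (hμ₀ : ∀ᵐ x ∂(μ₀ : Measure (Space n)), ‖x‖ ≤ R) {s t : ℝ} (hs : s ∈ Icc 0 T)
    (ht : t ∈ Icc 0 T) :
    wasserstein (μ t : Measure (Space n)) (μ s) ≤
      ENNReal.ofReal (C * Real.exp (C * T) * (R + 1) * |t - s|) := by
  have hbound := tendsto_real_toNNReal
    (((tendsto_growthBound n C R T).comp h.tendsto_atTop).const_mul C)
  have hlip := lipschitzOnWith_of_tendsto h.tendsto_stepCurve hbound (.of_forall fun k =>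
    (isGridBound_growthBound hV hC (h.isGridBound k).pos hμ₀).lipschitzOnWith_stepCurve)
  refine (hlip ht hs).trans_eq ?_
  have hR : 0 ≤ R := hμ₀.exists.elim fun x hx => (norm_nonneg x).trans hx
  rw [edist_dist, Real.dist_eq, ENNReal.ofReal_mul (by positivity)]
  congr 2
  ring_nf

end Convergence

end MDE

theorem theorem3p1 (n : ℕ) (V : MDE.PVF n) (C : ℝ) (hC : 0 < C)
    (hH1 : V.SupportSublinear C) (hH2 : V.WassersteinContinuous)
    (T : ℝ) (hT : 0 < T)
    (μ₀ : ProbabilityMeasure (MDE.Space n)) (hμ₀ : MDE.HasCompactSupp μ₀) :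
    ∃ μ : ℝ → ProbabilityMeasure (MDE.Space n),
      (∀ t ∈ Icc 0 T, MDE.HasCompactSupp (μ t)) ∧
      MDE.IsSolution V T μ₀ μ ∧
      (∃ φ : ℕ → ℕ, StrictMono φ ∧
        Tendsto (fun k => ⨆ t ∈ Icc 0 T,
          MDE.wasserstein (MDE.las V (φ k) μ₀ t) (μ t : Measure (MDE.Space n))) atTop (𝓝 0)) ∧
      (∀ R : ℝ, (μ₀ : Measure (MDE.Space n)).support ⊆ Metric.closedBall 0 R →
        ∀ t ∈ Icc 0 T, ∀ s ∈ Icc 0 T,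
          MDE.wasserstein (μ t : Measure (MDE.Space n)) (μ s : Measure (MDE.Space n)) ≤
            ENNReal.ofReal (C * Real.exp (C * T) * (R + 1) * |t - s|)) := by
  obtain ⟨R, hR⟩ := hμ₀.isBounded.subset_closedBall 0
  have hae := MDE.ae_norm_le_iff_support_subset.2 hR
  obtain ⟨μ, A, B, φ, hφ, hμ, hlim⟩ := MDE.exists_isLimitCurve hH1 hC hT.le hae
  refine ⟨μ, fun t ht => MDE.hasCompactSupp_of_mem_concentratedOn (hμ.mem_concentratedOn ht),
    hμ.isSolution hH2 hH1 hC.le hT.le, ⟨φ, hφ, hlim.congr' ?_⟩, fun R' hR' t ht s hs =>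
    hμ.wasserstein_le hH1 hC (MDE.ae_norm_le_iff_support_subset.2 hR') hs ht⟩
  filter_upwards [hφ.tendsto_atTop.eventually
    (MDE.eventually_las_eq_stepCurve (T := T) hH1 hC hae)] with k hk
  exact biSup_congr fun t ht => by rw [hk t ht]
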